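/- **Setting.** A problem $\mathcal P$ consists of request spaces $E_t$ (each with a metric $d$), non-empty action spaces $A_t$ and rewards $R_t(e_{1:t},a_{1:t})\in[0,L]$, $t\ge 1$. Given a past trajectory $\mathcal I=\{e_{1:m-1},a_{1:m-1}\}$, write $\mathrm{Val}(\mathcal P^{\mathcal I},e_{m:n},a_{m:n})=\sum_{t=m}^n R_t(e_{1:t},a_{1:t})$ and $\mathrm{Opt}(\mathcal P^{\mathcal I},e_{m:n})=\sup_{a_{m:n}}\mathrm{Val}(\mathcal P^{\mathcal I},e_{m:n},a_{m:n})$; for a randomized policy $\pi$ (a distribution on $A_t$ for every $e_{1:t},a_{1:t-1}$), $\mathrm{Val}(\cdot,\pi)$ is the expected value. The effective length $M(e_{1:\infty})$ is the least $m$ such that $R_t(e_{1:t},a_{1:t})=0$ for all $t>m$ and all actions; $e_{1:\infty}$ is finite if $M(\hat e_{1:n}\circ e_{n+1:\infty})<\infty$ for all $n$ and $\hat e_{1:n}$. All (partial) request sequences below are (parts of) finite ones. * $\mathcal P$ is *$f$-bounded-influence* if $|\mathrm{Opt}(\mathcal P^{\mathcal I},e_{m:n})-\mathrm{Opt}(\mathcal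 P^{\mathcal I'},e_{m:n})|\le fL$ for all $m\le n\le\infty$, all past trajectories $\mathcal I,\mathcal I'$ of $m-1$ periods and all $e_{m:n}$. * $\mathcal P$ is *$(u,v)$-strongly-Lipschitz* if $|\mathrm{Val}(\mathcal P^{\mathcal I},e_m\circ e_{m+1:n},a_{m:n})-\mathrm{Val}(\mathcal P^{\mathcal I},e_m'\circ e_{m+1:n},a_{m:n})|\le L\min(u\,d(e_m,e_m'),v)$ for all $m\le n<\infty$ and all data. * A *$\gamma$-offline oracle* returns, for all $m\le n\le\infty$, $\mathcal I=\{e_{1:m-1},a_{1:m-1}\}$ and $e_{m:n}$, actions with $\mathrm{Val}(\mathcal P^{\mathcal I},e_{m:n},a_{m:n})\ge\gamma\,\mathrm{Opt}(\mathcal P^{\mathcal I},e_{m:n})$. * An *$\eta$-online oracle* is a family of policies $\pi_0,\pi_1,\dots$, with $\pi_i=(\pi_{i,t})_{t>i}$ to be used after period $i$, such that $\mathrm{Val}(\mathcal P,e_{1:n},\pi_0)\ge\eta\,\mathrm{Opt}(\mathcal P,e_{1:n})$, and, for every $m\ge1$ and $\mathcal I=\{e_{1:m},a_{1:m}\}$,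 $\mathrm{Val}(\mathcal P^{\mathcal I},e_{m+1:m+n},\pi_m)\ge\eta\,\mathrm{Opt}(\mathcal P^{\mathcal I},e_{m+1:m+n})-fL$, for all $1\le n\le\infty$. * An *effective length estimator* returns, from $e_{1:i}$ and a finite $e^*_{1:\infty}$, an integer $\mathrm{EstimateM}\ge M(e_{1:i}\circ e^*_{i+1:\infty})$. **Batched AdaSwitch** (prediction $e^*_{1:\infty}$, parameters $\epsilon,\alpha,b,c,H$). Start in the conservative state with $\tau=1$. In period $t$, observe $e_t$. *Conservative state.* Sample $a_t\sim\pi_{\tau-1,t}(e_{1:t},a_{1:t-1})$ and execute it. Let $s$ be the average total reward over periods $\tau,\dots,t$ of $H t^5$ fresh independent simulations of $\pi_{\tau-1}$ on $e_{\tau:t}$ from the trajectory $\{e_{1:\tau-1},a_{1:\tau-1}\}$. If $s\ge\frac{16\eta}{\epsilon}\alpha cL$, switch to the predictive state with $\tau_p=t+1$, $\varphi=0$. *Predictive state.* Let $\mathcal I=\{e_{1:t-1},a_{1:t-1}\}$. If $t=\tau_p$, start a new batch: while $\tau_p\le \mathrm{EstimateM}(e_{1:t},e^*)$ and $\mathrm{Val}(\mathcal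 P^{\mathcal I},e_t\circ e^*_{t+1:\tau_p-1},a_{t:\tau_p-1})<\alpha cL$, let the offline oracle compute a new $a_{t:\tau_p}$ for the requests $e_t\circ e^*_{t+1:\tau_p}$ and increase $\tau_p$ by $1$; if afterwards still $\mathrm{Val}(\mathcal P^{\mathcal I},e_t\circ e^*_{t+1:\tau_p-1},a_{t:\tau_p-1})<\alpha cL$, set $\tau_p=\infty$ and let $a_{t:\infty}$ be arbitrary. Execute the planned $a_t$ and add $\min(d(e_t,e^*_t),c/b)$ to $\varphi$. If $\varphi\ge\frac{\gamma\alpha}{(\eta-\frac{15}{16}\epsilon)(\alpha+\gamma)}\cdot\frac{5\alpha c}{b}$, switch to the conservative state with $\tau=t+1$. **Theorem.** There is an absolute constant $C>0$ such that the following holds. Let $\mathcal P$ be $(u,v)$-strongly-Lipschitz and $f$-bounded-influence, with a $\gamma$-offline oracle ($\gamma>0$), an $\eta$-online oracle and an effective length estimator. Let $0<\epsilon<\eta$, $b=u$, $c=\max(v,f)$ with $c\ge b\ge1$, let $\alpha\ge3$ satisfy $\frac{\gamma\alpha}{\alpha+\gamma}\ge\eta-\frac{15\epsilon}{16}$, and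 let the integer $H$ satisfy $H\ge C\,\eta\alpha cL^3/\epsilon^2$. Let $e_{1:\infty}$ be a finite request sequence with $\mathrm{Opt}(\mathcal P,e_{1:\infty})>0$ and $e^*_{1:\infty}$ a prediction with $e_t\ne e^*_t$ for only finitely many $t$. Then the ratio of the expected total reward of batched AdaSwitch on $e_{1:\infty}$ to $\mathrm{Opt}(\mathcal P,e_{1:\infty})$ is at least $$\max\left(\eta-\epsilon,\ \gamma-\frac{\gamma^2}{\alpha}-\frac{L}{\epsilon\cdot\mathrm{Opt}(\mathcal P,e_{1:\infty})}\left(18\alpha c+\frac{7b\eta\varphi^*}{\gamma}\right)\right),$$ where $\varphi^*=\sum_{t\ge1}\min\left(d(e_t,e^*_t),\frac cb\right)\le\sum_{t\ge1} d(e_t,e^*_t)$. -/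

import Mathlib

open MeasureTheory ProbabilityTheory

universe uE uA

namespace OnlineDecision

noncomputable section

open Classical in
/-- `splice m x y` is the sequence `x₀, …, x_{m-1}, y_m, y_{m+1}, …`. -/
def splice {X : ℕ → Type*} (m : ℕ) (x y : ∀ i, X i) : ∀ i, X i :=
  fun i => if i < m then x i else y i

/-- A multi-period online decision problem with request sets `E t`, action sets `A t` and rewards
in `[0, L]`.  Periods are numbered from `0`, so index `t` is the `(t+1)`-st period.  The reward of
period `t` is a function of the requests and actions of the periods `0, …, t` only; it is written as
a function of entire sequences that ignores all later entries. -/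
structure Problem (E : ℕ → Type uE) (A : ℕ → Type uA) [∀ t, MeasurableSpace (A t)] where
  L : ℝ
  reward : ℕ → (∀ i, E i) → (∀ i, A i) → ℝ
  reward_mem : ∀ t e a, reward t e a ∈ Set.Icc 0 L
  reward_congr : ∀ t e e' a a', (∀ i ≤ t, e i = e' i) → (∀ i ≤ t, a i = a' i) →
    reward t e a = reward t e' a'
  measurable_reward : ∀ t e, Measurable (reward t e)

/-- A randomized policy: for every period `t`, a probability distribution on `A t` depending on the
requests of the periods `0, …, t` and the actions of the periods `0, …, t - 1`. -/
structure Policy (E : ℕ → Type uE) (A : ℕ → Type uA) [∀ t, MeasurableSpace (A t)] where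
  act : (t : ℕ) → (∀ i, E i) → Kernel (∀ i, A i) (A t)
  markov : ∀ t e, IsMarkovKernel (act t e)
  act_congr : ∀ t e e' a a', (∀ i ≤ t, e i = e' i) → (∀ i < t, a i = a' i) →
    act t e a = act t e' a'

/-- An offline algorithm: `plan m n e a` is the action sequence (of which the periods
`m ≤ t < n` matter) proposed for the requests `e_m, …, e_{n-1}`, given the requests and actions of
the periods before `m`. -/
structure OfflineAlgorithm (E : ℕ → Type uE) (A : ℕ → Type uA) [∀ t, MeasurableSpace (A t)] where
  plan : ℕ → ℕ∞ → (∀ i, E i) → (∀ i, A i) → ∀ i, A i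
  measurable_plan : ∀ m n e, Measurable (plan m n e)

section Problem

variable {E : ℕ → Type uE} {A : ℕ → Type uA} [∀ t, MeasurableSpace (A t)]

/-- The law of the action sequence after the policy `π` has chosen the actions of the periods
`m, …, m + k - 1`, the actions before period `m` being those of `a`.  (The entries from period
`m + k` on are those of `a`, and have no significance.) -/
def Policy.law (π : Policy E A) (e : ∀ i, E i) (m : ℕ) (a : ∀ i, A i) :
    ℕ → Measure (∀ i, A i)
  | 0 => Measure.dirac a
  | k + 1 => (Policy.law π e m a k).bind fun a' =>
      (π.act (m + k) e a').map (Function.update a' (m + k))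

namespace Problem

variable (P : Problem E A)

/-- The effective length of a request sequence: the least number `m` of periods after which no
reward can be collected any more (`⊤` if there is none). -/
def effLength (e : ∀ i, E i) : ℕ∞ :=
  sInf {m : ℕ∞ | ∀ t : ℕ, m ≤ (t : ℕ∞) → ∀ a, P.reward t e a = 0}

/-- A request sequence is finite if its effective length is finite, and remains so when any
initial segment is replaced. -/
def IsFinite (e : ∀ i, E i) : Prop :=
  ∀ (n : ℕ) (e' : ∀ i, E i), P.effLength (splice n e' e) < ⊤

open Classical in
/-- The reward collected in the periods `m ≤ t < n` (`n` may be `⊤`).  With the first `m` requests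
and actions regarded as the fixed past trajectory, this is the value of the remaining sequences in
the corresponding partial problem. -/
def val (m : ℕ) (n : ℕ∞) (e : ∀ i, E i) (a : ∀ i, A i) : ℝ :=
  ∑' t : ℕ, if m ≤ t ∧ (t : ℕ∞) < n then P.reward t e a else 0

/-- The optimal hindsight reward of the periods `m ≤ t < n` in the partial problem whose past
trajectory consists of the first `m` entries of `e` and `a`. -/
def opt (m : ℕ) (n : ℕ∞) (e : ∀ i, E i) (a : ∀ i, A i) : ℝ :=
  ⨆ a' : ∀ i, A i, P.val m n e (splice m a a')

/-- The optimal hindsight reward of the whole problem. -/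
def optTotal [∀ t, Nonempty (A t)] (e : ∀ i, E i) : ℝ :=
  P.opt 0 ⊤ e (fun _ => Classical.arbitrary _)

/-- `f`-bounded influence: replacing the past trajectory changes the optimal reward of any given
future request sequence by at most `f * L`. -/
def BoundedInfluence (f : ℝ) : Prop :=
  ∀ (m : ℕ) (n : ℕ∞), (m : ℕ∞) < n → ∀ (h h' e : ∀ i, E i) (a a' : ∀ i, A i), P.IsFinite e →
    |P.opt m n (splice m h e) a - P.opt m n (splice m h' e) a'| ≤ f * P.L

/-- `(u,v)`-strong Lipschitz continuity: changing the single request of period `m` changes the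
reward of any action sequence over the periods `m, …, n - 1` by at most
`L * min (u * d) v`. -/
def StronglyLipschitz [∀ t, MetricSpace (E t)] (u v : ℝ) : Prop :=
  ∀ m n : ℕ, m < n → ∀ (e : ∀ i, E i) (x : E m) (a : ∀ i, A i), P.IsFinite e →
    |P.val m n e a - P.val m n (Function.update e m x) a| ≤ P.L * min (u * dist (e m) x) v

open Classical in
/-- The expected reward of the policy `π` over the periods `m ≤ t < n`, given the first `m` requests
and actions. -/
def policyVal (π : Policy E A) (m : ℕ) (n : ℕ∞) (e : ∀ i, E i) (a : ∀ i, A i) : ℝ :=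
  ∑' t : ℕ, if m ≤ t ∧ (t : ℕ∞) < n then ∫ a', P.reward t e a' ∂(π.law e m a (t + 1 - m)) else 0

/-- A `γ`-offline oracle. -/
def IsOfflineOracle (γ : ℝ) (𝒜 : OfflineAlgorithm E A) : Prop :=
  ∀ (m : ℕ) (n : ℕ∞), (m : ℕ∞) < n → ∀ (e : ∀ i, E i) (a : ∀ i, A i), P.IsFinite e →
    γ * P.opt m n e a ≤ P.val m n e (splice m a (𝒜.plan m n e a))

/-- An `η`-online oracle (for an `f`-bounded-influence problem): `pol m` is the policy to be used from
period `m` on. -/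
def IsOnlineOracle (η f : ℝ) (pol : ℕ → Policy E A) : Prop :=
  (∀ n : ℕ∞, 0 < n → ∀ (e : ∀ i, E i) (a : ∀ i, A i), P.IsFinite e →
    η * P.opt 0 n e a ≤ P.policyVal (pol 0) 0 n e a) ∧
  (∀ (m : ℕ) (n : ℕ∞), 1 ≤ m → (m : ℕ∞) < n → ∀ (e : ∀ i, E i) (a : ∀ i, A i), P.IsFinite e →
    η * P.opt m n e a - f * P.L ≤ P.policyVal (pol m) m n e a)

/-- An effective length estimator: `est i e p` sees only the first `i` entries of `e`, and is an
upper bound for the effective length of `e₀, …, e_{i-1}, p_i, p_{i+1}, …`. -/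
structure IsEffLengthEstimator (est : ℕ → (∀ i, E i) → (∀ i, E i) → ℕ) : Prop where
  congr : ∀ i e e' p, (∀ k < i, e k = e' k) → est i e p = est i e' p
  le : ∀ i e p, P.IsFinite p → P.effLength (splice i e p) ≤ (est i e p : ℕ∞)

/-- The law of the Monte Carlo estimate of the expected reward of `π` over the periods
`m, …, n - 1` given the past before `m`: the mean of the rewards of `N` independent simulated
trajectories. -/
def monteCarlo (π : Policy E A) (e : ∀ i, E i) (m n N : ℕ) (a : ∀ i, A i) : Measure ℝ :=
  (Measure.pi fun _ : Fin N => π.law e m a (n - m)).map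
    fun ω => (∑ j, P.val m n e (ω j)) / N

end Problem

/-- The two states of the algorithm: `conservative τ` (the conservative state was entered at period
`τ`) and `predictive q` (the current batch ends just before period `q`, i.e. the next one starts at
period `q`). -/
inductive Mode where
  | conservative (τ : ℕ)
  | predictive (q : ℕ∞)

instance : MeasurableSpace Mode := ⊤

/-- The memory of the algorithm: its state, the error `φ` accumulated in the current predictive
state, the action plan of the current batch, and the actions executed so far. -/
abbrev Memory (A : ℕ → Type uA) : Type uA := Mode × ℝ × (∀ i, A i) × (∀ i, A i)

/-- The oracles, inputs and parameters of the algorithm. `fallback t a` is the arbitrary action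
sequence that is followed when a batch starts at period `t` but cannot collect enough reward. -/
structure AdaSwitch (P : Problem E A) where
  offline : OfflineAlgorithm E A
  online : ℕ → Policy E A
  est : ℕ → (∀ i, E i) → (∀ i, E i) → ℕ
  fallback : ℕ → (∀ i, A i) → ∀ i, A i
  prediction : ∀ i, E i
  η : ℝ
  γ : ℝ
  ε : ℝ
  α : ℝ
  b : ℝ
  c : ℝ
  H : ℕ

namespace AdaSwitch

variable {P : Problem E A} (S : AdaSwitch P)

open Classical in
/-- The loop that determines a batch starting at period `t`, with `e'` the real requests up to `t`
followed by the predicted ones. `q` is the current end of the batch (exclusive), `x` its current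
plan, and the first argument is the number of extensions still allowed before `q` reaches the
estimated effective length. -/
def extendBatch (t : ℕ) (e' : ∀ i, E i) (a : ∀ i, A i) : ℕ → ℕ → (∀ i, A i) → ℕ × (∀ i, A i)
  | 0, q, x => (q, x)
  | k + 1, q, x =>
    if P.val t q e' (splice t a x) < S.α * S.c * P.L then
      extendBatch t e' a k (q + 1) (S.offline.plan t ((q + 1 : ℕ) : ℕ∞) e' a)
    else (q, x)

open Classical in
/-- The end and the plan of a batch starting at period `t`. -/
def startBatch (t : ℕ) (e : ∀ i, E i) (a : ∀ i, A i) : ℕ∞ × (∀ i, A i) :=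
  let e' := splice (t + 1) e S.prediction
  let r := S.extendBatch t e' a (S.est (t + 1) e S.prediction - t) t (S.fallback t a)
  if P.val t r.1 e' (splice t a r.2) < S.α * S.c * P.L then (⊤, S.fallback t a)
  else ((r.1 : ℕ∞), r.2)

/-- The threshold on the estimated reward for leaving the conservative state. -/
def rewardThreshold : ℝ := 16 * S.η / S.ε * (S.α * S.c * P.L)

/-- The threshold on the accumulated error for leaving the predictive state. -/
def errorThreshold : ℝ :=
  S.γ * S.α / ((S.η - 15 / 16 * S.ε) * (S.α + S.γ)) * (5 * S.α * S.c / S.b)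

open Classical in
/-- One period of the algorithm on the request sequence `e`: the law of the memory after period `t`
given the memory before it. In the conservative state, the executed action and the Monte Carlo
estimate (from `H * (t + 1) ^ 5` fresh samples, period `t` being the `(t+1)`-st) are independent. -/
def step [∀ t, MetricSpace (E t)] (e : ∀ i, E i) (t : ℕ) : Memory A → Measure (Memory A)
  | (.conservative τ, φ, p, a) =>
    (((S.online τ).act t e a).prod
      (P.monteCarlo (S.online τ) e τ (t + 1) (S.H * (t + 1) ^ 5) a)).map fun xs =>
        if S.rewardThreshold ≤ xs.2 then
          (.predictive ((t + 1 : ℕ) : ℕ∞), 0, p, Function.update a t xs.1)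
        else (.conservative τ, φ, p, Function.update a t xs.1)
  | (.predictive q, φ, p, a) =>
    let batch := if (t : ℕ∞) = q then S.startBatch t e a else (q, p)
    let a' := Function.update a t (batch.2 t)
    let φ' := φ + min (dist (e t) (S.prediction t)) (S.c / S.b)
    if S.errorThreshold ≤ φ' then Measure.dirac (.conservative (t + 1), φ', batch.2, a')
    else Measure.dirac (.predictive batch.1, φ', batch.2, a')

/-- The law of the memory before period `t`. The initial plan and actions have no significance. -/
def memLaw [∀ t, MetricSpace (E t)] [∀ t, Nonempty (A t)] (e : ∀ i, E i) : ℕ → Measure (Memory A)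
  | 0 => Measure.dirac
      (.conservative 0, 0, fun _ => Classical.arbitrary _, fun _ => Classical.arbitrary _)
  | t + 1 => (memLaw e t).bind (S.step e t)

/-- The expected total reward of the algorithm on the request sequence `e`. -/
def value [∀ t, MetricSpace (E t)] [∀ t, Nonempty (A t)] (e : ∀ i, E i) : ℝ :=
  ∑' t : ℕ, ∫ s, P.reward t e s.2.2.2 ∂(S.memLaw e (t + 1))

/-- The competitive ratio of the algorithm on the request sequence `e`. -/
def comp [∀ t, MetricSpace (E t)] [∀ t, Nonempty (A t)] (e : ∀ i, E i) : ℝ :=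
  S.value e / P.optTotal e

end AdaSwitch

end Problem

end

end OnlineDecision

/-! The benchmark is `maxVal`, the optimum over all actions, past ones included. It is subadditive
under cutting the time axis, and by bounded influence it exceeds the optimum from any actual past by
at most `f * L`. Batches and conservative phases can therefore be compared with the optimum piece by
piece, at a loss of order c L per piece. The proof consists in paying for these losses.

A completed batch pays for itself: its planned reward V satisfies both V ≥ γ O, with O the optimum
on its requests, and V ≥ α c L, hence V ≥ (γα/(α+γ)) (O + c L). Only an unfinished batch, at most
one per predictive phase, costs α c L + c L. Strong Lipschitz continuity charges prediction errors
at a rate of order b L (`batch_loss`, `predictive_bound`).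

In a conservative phase entered at τ, every test simulates afresh from the trajectory before τ and
is independent of the actions executed since. Given that trajectory, each period thus has a fixed
switching probability, and the phase is analysed by a scalar backward induction
(`conservative_induction`). By Chebyshev, period t errs by a sixteenth of the threshold with
probability of order t⁻³, which is summable.

Robustness (`robust_bound`) takes κ = η - 15ε/16. A phase rightly left has a surplus over κ times
the optimum of at least 225/16 α c L, more than the following predictive phase can lose, as its
error is capped by `errorThreshold`. Wrong exits cost at most ε/16 of the optimum in total.
Consistency (`consistent_bound`) takes κ = γ - γ²/α. The first conservative phase loses at most
about 18 α c L / ε, and each later one is preceded by an accumulated error of at least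
`errorThreshold`, to which its loss is charged. Both bounds are strong inductions on the number of
periods left when a conservative phase begins. -/

namespace OnlineDecision

open Finset

/-! ### Splicing sequences. -/

section Splice

variable {X : ℕ → Type*}

theorem splice_of_lt {m i : ℕ} (h : i < m) (x y : ∀ i, X i) : splice m x y i = x i := by
  simp [splice, h]

theorem splice_of_le {m i : ℕ} (h : m ≤ i) (x y : ∀ i, X i) : splice m x y i = y i := by
  simp [splice, not_lt.2 h]

@[simp]
theorem splice_self (m : ℕ) (x : ∀ i, X i) : splice m x x = x := by
  funext i; simp [splice]

@[simp]
theorem splice_zero (x y : ∀ i, X i) : splice 0 x y = y := by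
  funext i; simp [splice]

theorem splice_splice_right (m n : ℕ) (x y z : ∀ i, X i) :
    splice m x (splice n y z) = splice (max m n) (splice m x y) z := by
  funext i
  simp only [splice, lt_max_iff]
  split_ifs <;> first | rfl | omega

theorem update_splice [DecidableEq ℕ] (j : ℕ) (x y : ∀ i, X i) :
    Function.update (splice j x y) j (x j) = splice (j + 1) x y := by
  funext i
  rcases lt_trichotomy i j with h | rfl | h
  · rw [Function.update_of_ne h.ne, splice_of_lt h, splice_of_lt (by omega)]
  · rw [Function.update_self, splice_of_lt (by omega)]
  · rw [Function.update_of_ne h.ne', splice_of_le h.le, splice_of_le (by omega)]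

end Splice

/-! ### Deterministic values, horizons and optima. -/

namespace Problem

variable {E : ℕ → Type uE} {A : ℕ → Type uA} [∀ t, MeasurableSpace (A t)] (P : Problem E A)

theorem reward_nonneg (t : ℕ) (e : ∀ i, E i) (a : ∀ i, A i) : 0 ≤ P.reward t e a :=
  (P.reward_mem t e a).1

theorem reward_le (t : ℕ) (e : ∀ i, E i) (a : ∀ i, A i) : P.reward t e a ≤ P.L :=
  (P.reward_mem t e a).2

theorem val_coe (m n : ℕ) (e : ∀ i, E i) (a : ∀ i, A i) :
    P.val m n e a = ∑ t ∈ Ico m n, P.reward t e a := by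
  classical
  rw [val, tsum_eq_sum (s := Ico m n)]
  · refine sum_congr rfl fun t ht => ?_
    rw [mem_Ico] at ht
    rw [if_pos ⟨ht.1, by exact_mod_cast ht.2⟩]
  · intro t ht
    rw [if_neg]
    rintro ⟨h1, h2⟩
    exact ht (mem_Ico.2 ⟨h1, by exact_mod_cast h2⟩)

theorem val_nonneg (m n : ℕ) (e : ∀ i, E i) (a : ∀ i, A i) : 0 ≤ P.val m n e a := by
  rw [val_coe]
  exact sum_nonneg fun t _ => P.reward_nonneg t e a

theorem val_le (m n : ℕ) (e : ∀ i, E i) (a : ∀ i, A i) : P.val m n e a ≤ ((n - m : ℕ) : ℝ) * P.L := by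
  rw [val_coe]
  refine (sum_le_card_nsmul _ _ P.L fun t _ => P.reward_le t e a).trans_eq ?_
  simp

theorem val_eq_zero {m n : ℕ} (h : n ≤ m) (e : ∀ i, E i) (a : ∀ i, A i) : P.val m n e a = 0 := by
  rw [val_coe, Ico_eq_empty_of_le h, sum_empty]

theorem val_congr {m n : ℕ} {e e' : ∀ i, E i} {a a' : ∀ i, A i} (he : ∀ i < n, e i = e' i)
    (ha : ∀ i < n, a i = a' i) : P.val m n e a = P.val m n e' a' := by
  rw [val_coe, val_coe]
  refine sum_congr rfl fun t ht => ?_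
  rw [mem_Ico] at ht
  exact P.reward_congr t e e' a a' (fun i hi => he i (by omega)) fun i hi => ha i (by omega)

theorem val_add {m k n : ℕ} (h1 : m ≤ k) (h2 : k ≤ n) (e : ∀ i, E i) (a : ∀ i, A i) :
    P.val m k e a + P.val k n e a = P.val m n e a := by
  simp only [val_coe]
  exact sum_Ico_consecutive _ h1 h2

theorem measurable_val (m n : ℕ) (e : ∀ i, E i) : Measurable (P.val m n e) := by
  have : P.val m n e = fun a => ∑ t ∈ Ico m n, P.reward t e a := by
    funext a; exact P.val_coe m n e a
  rw [this]
  exact Finset.measurable_sum _ fun t _ => P.measurable_reward t e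

/-- `N` is a horizon of `e` if no reward can be collected from period `N` on. -/
def IsHorizon (e : ∀ i, E i) (N : ℕ) : Prop := ∀ t ≥ N, ∀ a, P.reward t e a = 0

variable {P}

theorem isHorizon_of_effLength_le {e : ∀ i, E i} {N : ℕ} (h : P.effLength e ≤ N) :
    P.IsHorizon e N := by
  intro t ht a
  have hmem : P.effLength e ∈ {m : ℕ∞ | ∀ t : ℕ, m ≤ (t : ℕ∞) → ∀ a, P.reward t e a = 0} := by
    refine csInf_mem ⟨⊤, fun t ht => ?_⟩
    exact absurd ht (by simp)
  exact hmem t (h.trans (by exact_mod_cast ht)) a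

theorem IsHorizon.mono {e : ∀ i, E i} {N N' : ℕ} (h : P.IsHorizon e N) (hN : N ≤ N') :
    P.IsHorizon e N' := fun t ht a => h t (hN.trans ht) a

theorem IsFinite.exists_isHorizon {e : ∀ i, E i} (h : P.IsFinite e) : ∃ N, P.IsHorizon e N := by
  have h0 := h 0 e
  rw [splice_self] at h0
  obtain ⟨N, hN⟩ := ENat.ne_top_iff_exists.1 h0.ne
  exact ⟨N, isHorizon_of_effLength_le hN.ge⟩

theorem IsFinite.splice {e : ∀ i, E i} (h : P.IsFinite e) (n : ℕ) (e' : ∀ i, E i) :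
    P.IsFinite (splice n e' e) := by
  intro k e''
  rw [splice_splice_right]
  exact h _ _

/-- Beyond the last disagreement `p` follows `e`, so `p` is `e` with an initial segment replaced. -/
theorem IsFinite.of_finite_ne {e p : ∀ i, E i} (h : P.IsFinite e) (hp : {t | e t ≠ p t}.Finite) :
    P.IsFinite p := by
  obtain ⟨n, hn⟩ := hp.bddAbove
  have : p = OnlineDecision.splice (n + 1) p e := by
    funext i
    by_cases hi : i < n + 1
    · rw [splice_of_lt hi]
    · rw [splice_of_le (by omega)]
      by_contra hne
      have := hn (show i ∈ {t | e t ≠ p t} from fun h => hne h.symm)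
      omega
  rw [this]
  exact h.splice _ _

theorem IsHorizon.val_eq {e : ∀ i, E i} {N : ℕ} (h : P.IsHorizon e N) {m n : ℕ} (hn : N ≤ n)
    (a : ∀ i, A i) : P.val m n e a = P.val m N e a := by
  simp only [val_coe]
  symm
  refine sum_subset (Ico_subset_Ico_right hn) fun t ht ht' => ?_
  simp only [mem_Ico] at ht ht'
  exact h t (by omega) a

theorem IsHorizon.val_top {e : ∀ i, E i} {N : ℕ} (h : P.IsHorizon e N) (m : ℕ)
    (a : ∀ i, A i) : P.val m ⊤ e a = P.val m N e a := by
  classical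
  rw [val, val]
  refine tsum_congr fun t => ?_
  by_cases ht : t < N
  · simp [ht]
  · simp [ht, h t (by omega) a]

variable (P)

/-- The largest reward of the periods `m ≤ t < n` that any sequence of actions, including those
before period `m`, can collect. -/
noncomputable def maxVal (m n : ℕ) (e : ∀ i, E i) : ℝ := ⨆ a : ∀ i, A i, P.val m n e a

theorem bddAbove_val {ι : Type*} (m n : ℕ) (e : ∀ i, E i) (g : ι → ∀ i, A i) :
    BddAbove (Set.range fun a => P.val m n e (g a)) := by
  refine ⟨((n - m : ℕ) : ℝ) * P.L, ?_⟩
  rintro _ ⟨a, rfl⟩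
  exact P.val_le m n e _

theorem val_le_maxVal (m n : ℕ) (e : ∀ i, E i) (a : ∀ i, A i) : P.val m n e a ≤ P.maxVal m n e :=
  le_ciSup (P.bddAbove_val m n e id) a

theorem val_le_opt (m n : ℕ) (e : ∀ i, E i) (a a' : ∀ i, A i) :
    P.val m n e (splice m a a') ≤ P.opt m n e a :=
  le_ciSup (P.bddAbove_val m n e (splice m a)) a'

theorem opt_nonneg (m n : ℕ) (e : ∀ i, E i) (a : ∀ i, A i) : 0 ≤ P.opt m n e a :=
  (P.val_nonneg m n e _).trans (P.val_le_opt m n e a a)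

theorem opt_eq_zero {m n : ℕ} (h : n ≤ m) (e : ∀ i, E i) (a : ∀ i, A i) : P.opt m n e a = 0 := by
  simp [opt, P.val_eq_zero h]

theorem opt_zero (n : ℕ) (e : ∀ i, E i) (a : ∀ i, A i) : P.opt 0 n e a = P.maxVal 0 n e := by
  simp [opt, maxVal]

variable {P}

theorem IsHorizon.opt_eq {e : ∀ i, E i} {N : ℕ} (h : P.IsHorizon e N) {m n : ℕ}
    (hn : N ≤ n) (a : ∀ i, A i) : P.opt m n e a = P.opt m N e a := by
  simp only [opt, h.val_eq hn]

theorem BoundedInfluence.mul_nonneg {f : ℝ} (hf : P.BoundedInfluence f) {e : ∀ i, E i}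
    (he : P.IsFinite e) (a : ∀ i, A i) : 0 ≤ f * P.L :=
  (abs_nonneg _).trans (hf 0 1 (by simp) e e e a a he)

/-- Telescoping: predicted requests are replaced by real ones one at a time. Changing request `j`
leaves the rewards before `j` untouched, so the hypothesis applies to the window starting at `j`. -/
theorem StronglyLipschitz.abs_val_sub_splice_le [∀ t, MetricSpace (E t)] {u v : ℝ}
    (h : P.StronglyLipschitz u v) {e p : ∀ i, E i} (hp : P.IsFinite p) {t i j w : ℕ} (hti : t ≤ i)
    (hij : i ≤ j) (hjw : j ≤ w) (a : ∀ i, A i) :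
    |P.val t w (splice j e p) a - P.val t w (splice i e p) a|
      ≤ P.L * ∑ k ∈ Ico i j, min (u * dist (e k) (p k)) v := by
  induction j, hij using Nat.le_induction with
  | base => simp
  | succ j hij ih =>
    have ih := ih (by omega)
    rw [sum_Ico_succ_top hij, mul_add]
    have hstep : |P.val t w (splice (j + 1) e p) a - P.val t w (splice j e p) a|
        ≤ P.L * min (u * dist (e j) (p j)) v := by
      classical
      have h1 := h j w (by omega) (splice j e p) (e j) a (hp.splice _ _)
      have h2 : ∀ x, P.val t w x a = P.val t j x a + P.val j w x a := fun x =>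
        (P.val_add (hti.trans hij) (by omega) x a).symm
      rw [h2, h2]
      have h3 : P.val t j (splice (j + 1) e p) a = P.val t j (splice j e p) a :=
        P.val_congr (fun i hi => by rw [splice_of_lt (by omega), splice_of_lt hi]) fun _ _ => rfl
      rw [h3, add_sub_add_left_eq_sub, abs_sub_comm, ← update_splice]
      refine (le_of_eq ?_).trans (h1.trans_eq ?_)
      · congr!
      · rw [splice_of_le le_rfl, dist_comm]
    have := abs_sub_le (P.val t w (splice (j + 1) e p) a) (P.val t w (splice j e p) a)
      (P.val t w (splice i e p) a)
    linarith

variable (P)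

variable [∀ t, Nonempty (A t)]

theorem maxVal_nonneg (m n : ℕ) (e : ∀ i, E i) : 0 ≤ P.maxVal m n e :=
  (P.val_nonneg m n e (fun _ => Classical.arbitrary _)).trans (P.val_le_maxVal m n e _)

theorem maxVal_eq_zero {m n : ℕ} (h : n ≤ m) (e : ∀ i, E i) : P.maxVal m n e = 0 := by
  simp [maxVal, P.val_eq_zero h]

theorem maxVal_add_le {m k n : ℕ} (h1 : m ≤ k) (h2 : k ≤ n) (e : ∀ i, E i) :
    P.maxVal m n e ≤ P.maxVal m k e + P.maxVal k n e := by
  refine ciSup_le fun a => ?_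
  rw [← P.val_add h1 h2]
  exact add_le_add (P.val_le_maxVal _ _ _ _) (P.val_le_maxVal _ _ _ _)

theorem maxVal_anti_left {m m' n : ℕ} (h : m ≤ m') (e : ∀ i, E i) :
    P.maxVal m' n e ≤ P.maxVal m n e := by
  refine ciSup_le fun a => le_trans ?_ (P.val_le_maxVal m n e a)
  simp only [val_coe]
  exact sum_le_sum_of_subset_of_nonneg (Ico_subset_Ico_left h) fun t _ _ => P.reward_nonneg t e a

theorem IsHorizon.optTotal_eq {P : Problem E A} {e : ∀ i, E i} {N : ℕ} (h : P.IsHorizon e N) :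
    P.optTotal e = P.maxVal 0 N e := by
  simp [optTotal, opt, maxVal, h.val_top]

variable {P}

/-- Bounded influence is used with equal past requests: the competing past differs in its actions
only. -/
theorem BoundedInfluence.maxVal_le {f : ℝ} (hf : P.BoundedInfluence f) {e : ∀ i, E i}
    (he : P.IsFinite e) (m n : ℕ) (a : ∀ i, A i) :
    P.maxVal m n e ≤ P.opt m n e a + f * P.L := by
  rcases le_or_gt n m with h | h
  · rw [P.maxVal_eq_zero h, P.opt_eq_zero h, zero_add]
    exact hf.mul_nonneg he a
  · refine ciSup_le fun a' => ?_
    have h1 := P.val_le_opt m n e a' a'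
    have h2 := hf m n (by exact_mod_cast h) e e e a' a he
    rw [splice_self] at h1 h2
    have := (abs_le.1 h2).2
    linarith

end Problem

end OnlineDecision

namespace OnlineDecision

open Finset

/-! ### Binds, integrals and measurable families of measures. -/

section Bind

variable {α β γ : Type*} [MeasurableSpace α] [MeasurableSpace β] [MeasurableSpace γ]

theorem map_bind {μ : Measure α} {κ : α → Measure β} (hκ : Measurable κ) {g : β → γ}
    (hg : Measurable g) : (μ.bind κ).map g = μ.bind fun x => (κ x).map g := by
  ext s hs
  have h : Measurable fun x => (κ x).map g := (Measure.measurable_map g hg).comp hκ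
  rw [Measure.map_apply hg hs, Measure.bind_apply (hg hs) hκ.aemeasurable,
    Measure.bind_apply hs h.aemeasurable]
  simp [Measure.map_apply hg hs]

theorem bind_map {μ : Measure α} {g : α → β} (hg : Measurable g) {κ : β → Measure γ}
    (hκ : Measurable κ) : (μ.map g).bind κ = μ.bind fun x => κ (g x) := by
  ext s hs
  have h : Measurable fun x => κ (g x) := hκ.comp hg
  have h' : Measurable fun x => κ x s := (Measure.measurable_coe hs).comp hκ
  rw [Measure.bind_apply hs hκ.aemeasurable, Measure.bind_apply hs h.aemeasurable,
    lintegral_map h' hg]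

theorem isProbabilityMeasure_bind' {μ : Measure α} [IsProbabilityMeasure μ] {κ : α → Measure β}
    (hκ : Measurable κ) (h1 : ∀ a, IsProbabilityMeasure (κ a)) :
    IsProbabilityMeasure (μ.bind κ) :=
  isProbabilityMeasure_bind hκ.aemeasurable (Filter.Eventually.of_forall h1)

theorem integrable_of_abs_le {μ : Measure α} [IsFiniteMeasure μ] {f : α → ℝ}
    (hf : Measurable f) {C : ℝ} (hC : ∀ x, |f x| ≤ C) : Integrable f μ :=
  Integrable.of_bound hf.aestronglyMeasurable C (Filter.Eventually.of_forall hC)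

theorem integral_bind_of_abs_le {μ : Measure α} [IsProbabilityMeasure μ] {κ : α → Measure β}
    (hκ : Measurable κ) (h1 : ∀ a, IsProbabilityMeasure (κ a)) {f : β → ℝ} (hf : Measurable f)
    {C : ℝ} (hC : ∀ x, |f x| ≤ C) : ∫ x, f x ∂(μ.bind κ) = ∫ a, ∫ x, f x ∂(κ a) ∂μ := by
  have hp := isProbabilityMeasure_bind' (μ := μ) hκ h1
  let K : Kernel α β := ⟨κ, hκ⟩
  have h : (K ∘ₖ Kernel.const Unit μ) () = μ.bind κ := by
    rw [Kernel.comp_apply]; rfl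
  rw [← h, Kernel.integral_comp]
  · rfl
  · rw [h]; exact integrable_of_abs_le hf hC

theorem measurable_integral_of_measurable {κ : α → Measure β} (hκ : Measurable κ)
    {f : β → ℝ} (hf : Measurable f) : Measurable fun a => ∫ x, f x ∂(κ a) :=
  (StronglyMeasurable.integral_kernel (κ := ⟨κ, hκ⟩) hf.stronglyMeasurable).measurable

theorem abs_integral_le_of_abs_le {μ : Measure α} [IsProbabilityMeasure μ] {f : α → ℝ} {C : ℝ}
    (hC : ∀ x, |f x| ≤ C) : |∫ x, f x ∂μ| ≤ C := by
  have := norm_integral_le_of_norm_le_const (μ := μ) (f := f) (Filter.Eventually.of_forall hC)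
  simpa using this

theorem measurable_pi_const {ι : Type*} [Fintype ι] {κ : α → Measure β} (hκ : Measurable κ)
    (h1 : ∀ a, IsProbabilityMeasure (κ a)) :
    Measurable fun a => Measure.pi fun _ : ι => κ a := by
  refine Measurable.measure_of_isPiSystem_of_isProbabilityMeasure generateFrom_pi.symm
    isPiSystem_pi ?_
  rintro _ ⟨s, hs, rfl⟩
  simp only [Measure.pi_pi]
  exact Finset.measurable_prod _ fun i _ =>
    (Measure.measurable_coe (hs i (Set.mem_univ i))).comp hκ

theorem measurable_prod_measure {κ : α → Measure β} (hκ : Measurable κ)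
    (h1 : ∀ a, IsProbabilityMeasure (κ a)) {ν : α → Measure γ} (hν : Measurable ν)
    (h2 : ∀ a, IsProbabilityMeasure (ν a)) : Measurable fun a => (κ a).prod (ν a) := by
  let K : Kernel α β := ⟨κ, hκ⟩
  let V : Kernel α γ := ⟨ν, hν⟩
  have : IsMarkovKernel K := ⟨h1⟩
  have : IsMarkovKernel V := ⟨h2⟩
  have h : (fun a => (κ a).prod (ν a)) = K ×ₖ V := by
    funext a; rw [Kernel.prod_apply]; rfl
  rw [h]
  exact Kernel.measurable _

/-- The varying map `f a` becomes the single map `Function.uncurry f` once a Dirac mass at `a` is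
adjoined as a factor. -/
theorem measurable_map_measure {κ : α → Measure β} (hκ : Measurable κ)
    (h1 : ∀ a, IsProbabilityMeasure (κ a)) {f : α → β → γ} (hf : Measurable (Function.uncurry f)) :
    Measurable fun a => (κ a).map (f a) := by
  have h : (fun a => (κ a).map (f a)) =
      fun a => ((Measure.dirac a).prod (κ a)).map (Function.uncurry f) := by
    funext a
    rw [Measure.dirac_prod, Measure.map_map hf measurable_prodMk_left]
    rfl
  rw [h]
  exact (Measure.measurable_map _ hf).comp
    (measurable_prod_measure Measure.measurable_dirac (fun _ => inferInstance) hκ h1)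

end Bind

section Splice

variable {X : ℕ → Type*} [∀ i, MeasurableSpace (X i)]

theorem measurable_splice_right (m : ℕ) (x : ∀ i, X i) : Measurable (splice m x) := by
  refine measurable_pi_iff.2 fun i => ?_
  by_cases h : i < m
  · simp only [splice_of_lt h]; exact measurable_const
  · simp only [splice_of_le (not_lt.1 h)]; exact measurable_pi_apply i

theorem measurable_splice (m : ℕ) :
    Measurable fun z : (∀ i, X i) × (∀ i, X i) => splice m z.1 z.2 := by
  refine measurable_pi_iff.2 fun i => ?_
  by_cases h : i < m
  · simp only [splice_of_lt h]; exact (measurable_pi_apply i).comp measurable_fst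
  · simp only [splice_of_le (not_lt.1 h)]; exact (measurable_pi_apply i).comp measurable_snd

theorem measurable_splice_left (m : ℕ) (y : ∀ i, X i) : Measurable fun x => splice m x y :=
  (measurable_splice m).comp measurable_prodMk_right

end Splice

variable {E : ℕ → Type uE} {A : ℕ → Type uA} [∀ t, MeasurableSpace (A t)]

/-! ### Trajectory laws of a policy. -/

namespace Policy

variable (π : Policy E A) (e : ∀ i, E i)

instance (t : ℕ) : IsMarkovKernel (π.act t e) := π.markov t e

/-- The law of the action sequence after the action of period `t` has been chosen. -/
noncomputable def extend (t : ℕ) (a : ∀ i, A i) : Measure (∀ i, A i) :=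
  (π.act t e a).map (Function.update a t)

theorem measurable_extend (t : ℕ) : Measurable (π.extend e t) :=
  measurable_map_measure (Kernel.measurable _) (fun _ => inferInstance) measurable_update'

instance isProbabilityMeasure_extend (t : ℕ) (a : ∀ i, A i) :
    IsProbabilityMeasure (π.extend e t a) :=
  Measure.isProbabilityMeasure_map (measurable_update a).aemeasurable

theorem law_succ (m k : ℕ) (a : ∀ i, A i) :
    π.law e m a (k + 1) = (π.law e m a k).bind (π.extend e (m + k)) := rfl

instance isProbabilityMeasure_law (m k : ℕ) (a : ∀ i, A i) :
    IsProbabilityMeasure (π.law e m a k) := by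
  induction k with
  | zero => exact inferInstanceAs (IsProbabilityMeasure (Measure.dirac a))
  | succ k ih =>
    rw [law_succ]
    exact isProbabilityMeasure_bind' (π.measurable_extend e _) fun a => inferInstance

theorem measurable_law (m k : ℕ) : Measurable fun a => π.law e m a k := by
  induction k with
  | zero => exact Measure.measurable_dirac
  | succ k ih => exact (Measure.measurable_bind' (π.measurable_extend e _)).comp ih

/-- The law of the actions does not depend on the irrelevant later entries of the past. -/
theorem law_eq_map_splice (m k : ℕ) {a a' : ∀ i, A i} (h : ∀ i < m, a i = a' i) :
    π.law e m a' k = (π.law e m a k).map fun x => splice (m + k) x a' := by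
  induction k with
  | zero =>
    change Measure.dirac a' = (Measure.dirac a).map _
    rw [Measure.map_dirac' (measurable_splice_left _ _)]
    congr 1
    funext i
    by_cases hi : i < m
    · rw [splice_of_lt (by omega), h i hi]
    · rw [splice_of_le (by omega)]
  | succ k ih =>
    rw [law_succ, ih, bind_map (measurable_splice_left _ _) (π.measurable_extend e _), law_succ,
      map_bind (π.measurable_extend e _) (measurable_splice_left _ _)]
    congr 1
    funext x
    rw [extend, extend, Measure.map_map (measurable_splice_left _ _) (measurable_update x),
      π.act_congr (m + k) e e (splice (m + k) x a') x (fun _ _ => rfl)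
        fun i hi => splice_of_lt hi _ _]
    congr 1
    funext z i
    simp only [Function.comp_apply]
    rcases lt_trichotomy i (m + k) with hi | rfl | hi
    · rw [Function.update_of_ne hi.ne, splice_of_lt hi, splice_of_lt (by omega),
        Function.update_of_ne hi.ne]
    · rw [Function.update_self, splice_of_lt (by omega), Function.update_self]
    · rw [Function.update_of_ne hi.ne', splice_of_le hi.le, splice_of_le (by omega)]

/-- The policy does not alter the past. -/
theorem map_splice_law (m k : ℕ) (a : ∀ i, A i) :
    (π.law e m a k).map (splice m a) = π.law e m a k := by
  induction k with
  | zero =>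
    change (Measure.dirac a).map _ = Measure.dirac a
    rw [Measure.map_dirac' (measurable_splice_right _ _), splice_self]
  | succ k ih =>
    have hm : Measurable fun x => (π.extend e (m + k) x).map (splice m a) :=
      (Measure.measurable_map _ (measurable_splice_right _ _)).comp (π.measurable_extend e _)
    rw [law_succ, map_bind (π.measurable_extend e _) (measurable_splice_right _ _)]
    conv_lhs => rw [← ih]
    conv_rhs => rw [← ih]
    rw [bind_map (measurable_splice_right _ _) (π.measurable_extend e _),
      bind_map (measurable_splice_right _ _) hm]
    congr 1
    funext x
    rw [extend, Measure.map_map (measurable_splice_right _ _) (measurable_update _)]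
    congr 1
    funext z i
    simp only [Function.comp_apply]
    by_cases hi : i < m
    · rw [splice_of_lt hi, Function.update_of_ne (by omega), splice_of_lt hi]
    · rw [splice_of_le (by omega)]

theorem integral_law_succ (m k : ℕ) (a : ∀ i, A i) {F : (∀ i, A i) → ℝ} (hF : Measurable F)
    {C : ℝ} (hC : ∀ x, |F x| ≤ C) (hdep : ∀ x y : ∀ i, A i, (∀ i < m + k, x i = y i) → F x = F y) :
    ∫ x, F x ∂(π.law e m a (k + 1)) = ∫ x, F x ∂(π.law e m a k) := by
  rw [law_succ, integral_bind_of_abs_le (π.measurable_extend e _) (fun _ => inferInstance) hF hC]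
  congr 1
  funext x
  rw [extend, integral_map (measurable_update _).aemeasurable hF.aestronglyMeasurable]
  have : ∀ z, F (Function.update x (m + k) z) = F x := fun z =>
    hdep _ _ fun i hi => Function.update_of_ne hi.ne _ _
  simp [this]

end Policy

/-! ### Policy values and their Monte Carlo estimates. -/

namespace Problem

variable (P : Problem E A) (π : Policy E A) (e : ∀ i, E i)

theorem abs_reward_le (t : ℕ) (e : ∀ i, E i) (a : ∀ i, A i) : |P.reward t e a| ≤ P.L := by
  rw [abs_of_nonneg (P.reward_nonneg t e a)]
  exact P.reward_le t e a

theorem abs_val_le (m n : ℕ) (e : ∀ i, E i) (a : ∀ i, A i) :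
    |P.val m n e a| ≤ ((n - m : ℕ) : ℝ) * P.L := by
  rw [abs_of_nonneg (P.val_nonneg m n e a)]
  exact P.val_le m n e a

theorem policyVal_coe (m k : ℕ) (a : ∀ i, A i) :
    P.policyVal π m ((m + k : ℕ) : ℕ∞) e a
      = ∑ j ∈ range k, ∫ x, P.reward (m + j) e x ∂(π.law e m a (j + 1)) := by
  classical
  rw [policyVal, tsum_eq_sum (s := Ico m (m + k)), sum_Ico_eq_sum_range, Nat.add_sub_cancel_left]
  · refine sum_congr rfl fun j hj => ?_
    rw [mem_range] at hj
    rw [if_pos ⟨by omega, by exact_mod_cast Nat.add_lt_add_left hj m⟩,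
      show m + j + 1 - m = j + 1 by omega]
  · intro t ht
    rw [if_neg]
    rintro ⟨h1, h2⟩
    exact ht (mem_Ico.2 ⟨h1, by exact_mod_cast h2⟩)

theorem integral_val_law (m k : ℕ) (a : ∀ i, A i) :
    ∫ x, P.val m ((m + k : ℕ) : ℕ∞) e x ∂(π.law e m a k)
      = ∑ j ∈ range k, ∫ x, P.reward (m + j) e x ∂(π.law e m a (j + 1)) := by
  induction k with
  | zero =>
    have : ∀ x, P.val m ((m + 0 : ℕ) : ℕ∞) e x = 0 := fun x => P.val_eq_zero le_rfl e x
    simp only [this]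
    simp
  | succ k ih =>
    have h : ∀ x, P.val m ((m + (k + 1) : ℕ) : ℕ∞) e x
        = P.val m ((m + k : ℕ) : ℕ∞) e x + P.reward (m + k) e x := by
      intro x
      rw [P.val_coe, P.val_coe, ← add_assoc, sum_Ico_succ_top (by omega)]
    simp only [h]
    rw [integral_add (integrable_of_abs_le (P.measurable_val _ _ _) (P.abs_val_le _ _ _))
      (integrable_of_abs_le (P.measurable_reward _ _) (P.abs_reward_le _ _)), sum_range_succ, ← ih,
      π.integral_law_succ e m k a (P.measurable_val _ _ _) (P.abs_val_le _ _ _)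
        fun x y hxy => P.val_congr (fun _ _ => rfl) hxy]

section MonteCarlo

variable (m n N : ℕ)

theorem measurable_mean : Measurable fun ω : Fin N → ∀ i, A i => (∑ j, P.val m n e (ω j)) / N :=
  (Finset.measurable_sum _ fun j _ =>
    (P.measurable_val m n e).comp (measurable_pi_apply j)).div_const _

theorem measurable_monteCarlo : Measurable (P.monteCarlo π e m n N) :=
  (Measure.measurable_map _ (P.measurable_mean e m n N)).comp
    (measurable_pi_const (π.measurable_law e m _) fun _ => inferInstance)

instance isProbabilityMeasure_monteCarlo (a : ∀ i, A i) :
    IsProbabilityMeasure (P.monteCarlo π e m n N a) :=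
  Measure.isProbabilityMeasure_map (P.measurable_mean e m n N).aemeasurable

/-- The estimate depends on the trajectory law only through the law of its value; this removes the
meaningless later entries of the past in `monteCarlo_congr`. -/
theorem monteCarlo_eq_map (a : ∀ i, A i) :
    P.monteCarlo π e m n N a
      = (Measure.pi fun _ : Fin N => (π.law e m a (n - m)).map (P.val m n e)).map
        fun s : Fin N → ℝ => (∑ j, s j) / (N : ℝ) := by
  have h : Measurable fun s : Fin N → ℝ => (∑ j, s j) / (N : ℝ) := by fun_prop
  have hv := P.measurable_val m n e
  have : ∀ _ : Fin N, SigmaFinite ((π.law e m a (n - m)).map (P.val m n e)) := fun _ => by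
    have := Measure.isProbabilityMeasure_map (μ := π.law e m a (n - m)) hv.aemeasurable
    infer_instance
  rw [← Measure.pi_map_pi (fun _ => hv.aemeasurable), Measure.map_map h (by fun_prop)]
  rfl

theorem monteCarlo_congr (hmn : m ≤ n) {a a' : ∀ i, A i} (h : ∀ i < m, a i = a' i) :
    P.monteCarlo π e m n N a' = P.monteCarlo π e m n N a := by
  rw [P.monteCarlo_eq_map π e m n N, P.monteCarlo_eq_map π e m n N,
    π.law_eq_map_splice e m (n - m) h,
    Measure.map_map (P.measurable_val m n e) (measurable_splice_left _ _)]
  have : (P.val m n e ∘ fun x => splice (m + (n - m)) x a') = P.val m n e := by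
    funext x
    exact P.val_congr (fun _ _ => rfl) fun i hi => splice_of_lt (by omega) _ _
  rw [this]

/-- Chebyshev for `N` independent values in [0, k L], each of variance at most (k L / 2)², whence
the factor 4. -/
theorem monteCarlo_abs_sub_ge_le (hN : 0 < N) {k : ℕ} (a : ∀ i, A i) {δ : ℝ} (hδ : 0 < δ) :
    (P.monteCarlo π e m ((m + k : ℕ)) N a).real
      {s | δ ≤ |s - ∑ j ∈ range k, ∫ x, P.reward (m + j) e x ∂(π.law e m a (j + 1))|}
      ≤ (k * P.L) ^ 2 / (4 * N * δ ^ 2) := by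
  set μ := ∑ j ∈ range k, ∫ x, P.reward (m + j) e x ∂(π.law e m a (j + 1)) with hμ
  have hNr : (0 : ℝ) < N := by exact_mod_cast hN
  let Q : Measure (Fin N → ∀ i, A i) := Measure.pi fun _ : Fin N => π.law e m a k
  let X : Fin N → (Fin N → ∀ i, A i) → ℝ := fun j ω => P.val m ((m + k : ℕ) : ℕ∞) e (ω j)
  have hX : ∀ j, Measurable (X j) := fun j =>
    (P.measurable_val m _ e).comp (measurable_pi_apply j)
  have hXb : ∀ j ω, X j ω ∈ Set.Icc 0 (k * P.L) := fun j ω =>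
    ⟨P.val_nonneg _ _ _ _, (P.val_le _ _ _ _).trans_eq (by simp)⟩
  have hXabs : ∀ j ω, |X j ω| ≤ k * P.L := fun j ω => by
    rw [abs_of_nonneg (hXb j ω).1]; exact (hXb j ω).2
  have hL2 : ∀ j, MemLp (X j) 2 Q := fun j =>
    MemLp.of_bound (hX j).aestronglyMeasurable (k * P.L) (Filter.Eventually.of_forall (hXabs j))
  have hind : iIndepFun X Q := iIndepFun_pi
    (X := fun (_ : Fin N) => P.val m ((m + k : ℕ) : ℕ∞) e)
    fun _ => (P.measurable_val m _ e).aemeasurable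
  have hvar : Var[∑ j, X j; Q] ≤ N * ((k * P.L) / 2) ^ 2 := by
    rw [IndepFun.variance_sum (fun j _ => hL2 j) fun i _ j _ hij => hind.indepFun hij]
    refine (sum_le_card_nsmul _ _ (((k * P.L) / 2) ^ 2) fun j _ => ?_).trans_eq (by simp)
    · simpa using variance_le_sq_of_bounded (Filter.Eventually.of_forall (hXb j)) (hX j).aemeasurable
  have hmean : ∀ j, ∫ ω, X j ω ∂Q = μ := by
    intro j
    rw [hμ, ← P.integral_val_law π e m k a]
    have hmp := measurePreserving_eval (fun _ : Fin N => π.law e m a k) j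
    rw [← hmp.map_eq, integral_map hmp.measurable.aemeasurable
      (P.measurable_val m _ e).aestronglyMeasurable]
  have hmeanS : ∫ ω, (∑ j, X j) ω ∂Q = N * μ := by
    simp only [Finset.sum_apply]
    rw [integral_finsetSum _ fun j _ => (hL2 j).integrable (by norm_num)]
    simp [hmean]
  have hcheb := meas_ge_le_variance_div_sq (μ := Q) (X := ∑ j, X j)
    (memLp_finsetSum' _ fun j _ => hL2 j) (c := N * δ) (by positivity)
  rw [hmeanS] at hcheb
  have hset : (fun ω : Fin N → ∀ i, A i => (∑ j, P.val m ((m + k : ℕ) : ℕ∞) e (ω j)) / (N : ℝ)) ⁻¹'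
      {s | δ ≤ |s - μ|} = {ω | N * δ ≤ |(∑ j, X j) ω - N * μ|} := by
    ext ω
    simp only [Set.mem_preimage, Set.mem_ofPred_eq, Finset.sum_apply]
    have : (∑ j, X j ω) - N * μ = N * ((∑ j, X j ω) / N - μ) := by field_simp
    rw [this, abs_mul, abs_of_pos hNr, mul_le_mul_iff_right₀ hNr]
  rw [monteCarlo, measureReal_def, Measure.map_apply (P.measurable_mean e m _ N)
    (measurableSet_le measurable_const (by fun_prop)), hset, Nat.add_sub_cancel_left]
  refine ENNReal.toReal_le_of_le_ofReal (by positivity) (hcheb.trans (ENNReal.ofReal_le_ofReal ?_))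
  calc Var[∑ j, X j; Q] / (N * δ) ^ 2 ≤ (N * ((k * P.L) / 2) ^ 2) / (N * δ) ^ 2 := by gcongr
    _ = (k * P.L) ^ 2 / (4 * N * δ ^ 2) := by field_simp; norm_num

end MonteCarlo

end Problem

end OnlineDecision

/-! ### Measurability of the algorithm and the expected reward to go. -/

namespace OnlineDecision

open Finset

instance : Countable Mode := by
  let f : Mode → ℕ ⊕ Option ℕ := fun
    | .conservative τ => Sum.inl τ
    | .predictive q => Sum.inr q
  refine Function.Injective.countable (f := f) ?_
  rintro (a | a) (b | b) h
  · exact congrArg _ (Sum.inl.inj h)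
  · exact absurd h (by simp [f])
  · exact absurd h (by simp [f])
  · exact congrArg _ (Sum.inr.inj h)

variable {E : ℕ → Type uE} {A : ℕ → Type uA} [∀ t, MeasurableSpace (A t)]

namespace AdaSwitch

variable {P : Problem E A} (S : AdaSwitch P)

theorem measurable_extendBatch (t : ℕ) (e : ∀ i, E i) (k q : ℕ) :
    Measurable fun z : (∀ i, A i) × (∀ i, A i) => S.extendBatch t e z.1 k q z.2 := by
  induction k generalizing q with
  | zero => exact measurable_const.prodMk measurable_snd
  | succ k ih =>
    simp only [extendBatch]
    refine Measurable.ite ?_ ?_ (measurable_const.prodMk measurable_snd)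
    · exact measurableSet_lt ((P.measurable_val t q e).comp (measurable_splice t)) measurable_const
    · exact (ih (q + 1)).comp (measurable_fst.prodMk
        ((S.offline.measurable_plan t _ e).comp measurable_fst))

section StartBatch

variable (hfb : ∀ t, Measurable (S.fallback t)) (t : ℕ) (e : ∀ i, E i)
include hfb

/-- The test function `g` need only be measurable for each fixed batch end: the loop returns a
natural number, so there are countably many cases, and no σ-algebra on `ℕ∞` enters. -/
theorem measurable_startBatch {β γ : Type*} [MeasurableSpace β] [MeasurableSpace γ]
    (g : ℕ∞ × (∀ i, A i) → β → γ)
    (hg : ∀ q, Measurable fun z : (∀ i, A i) × β => g (q, z.1) z.2) :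
    Measurable fun z : (∀ i, A i) × β => g (S.startBatch t e z.1) z.2 := by
  classical
  set e' := splice (t + 1) e S.prediction
  set k := S.est (t + 1) e S.prediction - t
  let r : (∀ i, A i) → ℕ × (∀ i, A i) := fun a => S.extendBatch t e' a k t (S.fallback t a)
  have hr : Measurable r :=
    (S.measurable_extendBatch t e' k t).comp (measurable_id.prodMk (hfb t))
  have hv : Measurable fun a => P.val t (r a).1 e' (splice t a (r a).2) := by
    have h : Measurable fun z : ℕ × ((∀ i, A i) × (∀ i, A i)) =>
        P.val t z.1 e' (splice t z.2.1 z.2.2) :=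
      measurable_from_prod_countable_right fun n =>
        (P.measurable_val t n e').comp (measurable_splice t)
    exact h.comp ((measurable_fst.comp hr).prodMk (measurable_id.prodMk (measurable_snd.comp hr)))
  have heq : (fun z : (∀ i, A i) × β => g (S.startBatch t e z.1) z.2) =
      fun z => if P.val t (r z.1).1 e' (splice t z.1 (r z.1).2) < S.α * S.c * P.L
        then g (⊤, S.fallback t z.1) z.2 else g ((r z.1).1, (r z.1).2) z.2 := by
    funext z
    simp only [startBatch]
    split_ifs <;> simp_all [r, e', k]
  rw [heq]
  refine Measurable.ite (measurableSet_lt (hv.comp measurable_fst) measurable_const)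
    ((hg ⊤).comp (((hfb t).comp measurable_fst).prodMk measurable_snd)) ?_
  have h : Measurable fun w : ℕ × ((∀ i, A i) × β) => g ((w.1 : ℕ∞), w.2.1) w.2.2 :=
    measurable_from_prod_countable_right fun n => hg n
  have hr' : Measurable fun z : (∀ i, A i) × β => r z.1 := hr.comp measurable_fst
  exact h.comp ((measurable_fst.comp hr').prodMk ((measurable_snd.comp hr').prodMk measurable_snd))

end StartBatch

theorem measurable_reward_memory (e : ∀ i, E i) (t : ℕ) :
    Measurable fun s : Memory A => P.reward t e s.2.2.2 :=
  (P.measurable_reward t e).comp (by fun_prop)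

section Step

variable [∀ t, MetricSpace (E t)] (e : ∀ i, E i)

instance isProbabilityMeasure_step (t : ℕ) (s : Memory A) :
    IsProbabilityMeasure (S.step e t s) := by
  classical
  obtain ⟨τ | q, φ, p, a⟩ := s
  · simp only [step]
    refine Measure.isProbabilityMeasure_map (Measurable.aemeasurable ?_)
    have hu : Measurable fun xs : A t × ℝ => Function.update a t xs.1 :=
      (measurable_update a).comp measurable_fst
    exact Measurable.ite (measurableSet_le measurable_const measurable_snd) (by fun_prop)
      (by fun_prop)
  · simp only [step]
    split_ifs <;> infer_instance

theorem measurable_step (hfb : ∀ t, Measurable (S.fallback t)) (t : ℕ) :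
    Measurable (S.step e t) := by
  classical
  refine measurable_from_prod_countable_right fun mode => ?_
  obtain τ | q := mode
  · simp only [step]
    have hκ : Measurable fun z : ℝ × (∀ i, A i) × (∀ i, A i) => ((S.online τ).act t e z.2.2).prod
        (P.monteCarlo (S.online τ) e τ (t + 1) (S.H * (t + 1) ^ 5) z.2.2) :=
      (measurable_prod_measure (Kernel.measurable _) (fun _ => inferInstance)
        (P.measurable_monteCarlo _ e _ _ _) (fun _ => inferInstance)).comp
        (measurable_snd.comp measurable_snd)
    refine measurable_map_measure hκ (fun _ => inferInstance) ?_
    have hu : Measurable fun z : (ℝ × (∀ i, A i) × (∀ i, A i)) × (A t × ℝ) =>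
        Function.update z.1.2.2 t z.2.1 :=
      measurable_update'.comp ((measurable_snd.comp (measurable_snd.comp measurable_fst)).prodMk
        (measurable_fst.comp measurable_snd))
    exact Measurable.ite (measurableSet_le measurable_const (measurable_snd.comp measurable_snd))
      (by fun_prop) (by fun_prop)
  · simp only [step]
    let d := min (dist (e t) (S.prediction t)) (S.c / S.b)
    let G : (ℕ∞ × (∀ i, A i)) → (ℝ × (∀ i, A i)) → Memory A := fun r z =>
      if S.errorThreshold ≤ z.1 + d then
        (.conservative (t + 1), z.1 + d, r.2, Function.update z.2 t (r.2 t))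
      else (.predictive r.1, z.1 + d, r.2, Function.update z.2 t (r.2 t))
    have hG : ∀ q, Measurable fun w : (∀ i, A i) × (ℝ × (∀ i, A i)) => G (q, w.1) w.2 := by
      intro q
      have hu : Measurable fun w : (∀ i, A i) × (ℝ × (∀ i, A i)) =>
          Function.update w.2.2 t (w.1 t) :=
        measurable_update'.comp ((measurable_snd.comp measurable_snd).prodMk
          ((measurable_pi_apply t).comp measurable_fst))
      exact Measurable.ite (measurableSet_le measurable_const (by fun_prop)) (by fun_prop)
        (by fun_prop)
    let B : (ℝ × (∀ i, A i) × (∀ i, A i)) → Memory A := fun z =>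
      if (t : ℕ∞) = q then G (S.startBatch t e z.2.2) (z.1, z.2.2) else G (q, z.2.1) (z.1, z.2.2)
    have hB : Measurable B := by
      by_cases hq : (t : ℕ∞) = q
      · simp only [B, if_pos hq]
        exact (S.measurable_startBatch hfb t e G hG).comp
          ((measurable_snd.comp measurable_snd).prodMk
            (measurable_fst.prodMk (measurable_snd.comp measurable_snd)))
      · simp only [B, if_neg hq]
        exact (hG q).comp ((measurable_fst.comp measurable_snd).prodMk
          (measurable_fst.prodMk (measurable_snd.comp measurable_snd)))
    convert Measure.measurable_dirac.comp hB using 1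
    funext z
    by_cases h1 : (t : ℕ∞) = q <;> simp only [B, G, d, Function.comp_apply, h1, if_true, if_false]
      <;> split_ifs <;> rfl

/-- The expected reward of the next `k` periods if the memory before period `t` is `s`. -/
noncomputable def valueToGo : ℕ → ℕ → Memory A → ℝ
  | 0, _, _ => 0
  | k + 1, t, s => ∫ s', (P.reward t e s'.2.2.2 + valueToGo k (t + 1) s') ∂(S.step e t s)

theorem measurable_valueToGo (hfb : ∀ t, Measurable (S.fallback t)) (k t : ℕ) :
    Measurable (S.valueToGo e k t) := by
  induction k generalizing t with
  | zero => exact measurable_const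
  | succ k ih =>
    exact measurable_integral_of_measurable (S.measurable_step e hfb t)
      ((measurable_reward_memory e t).add (ih (t + 1)))

theorem valueToGo_nonneg (k t : ℕ) (s : Memory A) : 0 ≤ S.valueToGo e k t s := by
  induction k generalizing t s with
  | zero => exact le_rfl
  | succ k ih => exact integral_nonneg fun s' => add_nonneg (P.reward_nonneg _ _ _) (ih _ _)

theorem abs_valueToGo_le (k t : ℕ) (s : Memory A) : |S.valueToGo e k t s| ≤ k * P.L := by
  induction k generalizing t s with
  | zero => simp [valueToGo]
  | succ k ih =>
    refine abs_integral_le_of_abs_le fun s' => (abs_add_le _ _).trans ?_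
    have h1 := P.abs_reward_le t e s'.2.2.2
    have h2 := ih (t + 1) s'
    push_cast
    linarith

theorem isProbabilityMeasure_memLaw [∀ t, Nonempty (A t)] (hfb : ∀ t, Measurable (S.fallback t))
    (t : ℕ) : IsProbabilityMeasure (S.memLaw e t) := by
  induction t with
  | zero => exact Measure.dirac.isProbabilityMeasure
  | succ t ih => exact isProbabilityMeasure_bind' (S.measurable_step e hfb t) fun _ => inferInstance

/-- The tower property; it ties the recursion of `valueToGo` to the series defining `value`. -/
theorem integral_valueToGo [∀ t, Nonempty (A t)] (hfb : ∀ t, Measurable (S.fallback t))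
    (k t : ℕ) : ∫ s, S.valueToGo e k t s ∂(S.memLaw e t)
      = ∑ j ∈ range k, ∫ s, P.reward (t + j) e s.2.2.2 ∂(S.memLaw e (t + j + 1)) := by
  have hp := S.isProbabilityMeasure_memLaw e hfb
  induction k generalizing t with
  | zero => simp [valueToGo]
  | succ k ih =>
    rw [sum_range_succ']
    have hr := measurable_reward_memory (P := P) e t
    have hg := S.measurable_valueToGo e hfb k (t + 1)
    have h1 := integral_bind_of_abs_le (μ := S.memLaw e t) (S.measurable_step e hfb t)
      (fun _ => inferInstance) (hr.add hg) (C := P.L + k * P.L) fun s =>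
        (abs_add_le _ _).trans (add_le_add (P.abs_reward_le _ _ _) (S.abs_valueToGo_le e _ _ _))
    simp only [Pi.add_apply] at h1
    have hq := hp (t + 1)
    simp only [valueToGo]
    rw [← h1]
    change ∫ s, (P.reward t e s.2.2.2 + S.valueToGo e k (t + 1) s) ∂(S.memLaw e (t + 1)) = _
    rw [integral_add (integrable_of_abs_le hr fun _ => P.abs_reward_le _ _ _)
      (integrable_of_abs_le hg (S.abs_valueToGo_le e _ _)), ih (t + 1), add_comm]
    congr 1
    refine sum_congr rfl fun j _ => ?_
    rw [show t + 1 + j = t + (j + 1) by ring]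

theorem value_eq_valueToGo [∀ t, Nonempty (A t)] (hfb : ∀ t, Measurable (S.fallback t)) {N : ℕ}
    (hN : P.IsHorizon e N) :
    S.value e = S.valueToGo e N 0
      (.conservative 0, 0, fun _ => Classical.arbitrary _, fun _ => Classical.arbitrary _) := by
  have h := S.integral_valueToGo e hfb N 0
  rw [memLaw, integral_dirac' _ _ (S.measurable_valueToGo e hfb N 0).stronglyMeasurable] at h
  rw [h, value, tsum_eq_sum (s := range N)]
  · simp
  · intro t ht
    rw [mem_range, not_lt] at ht
    simp [hN t ht]

end Step

end AdaSwitch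

end OnlineDecision

/-! ### Batches and the predictive state. -/

namespace OnlineDecision

open Finset

variable {E : ℕ → Type uE} {A : ℕ → Type uA} [∀ t, MeasurableSpace (A t)]

namespace AdaSwitch

variable {P : Problem E A} (S : AdaSwitch P)

/-- The prediction error of period `t`, truncated at `c / b`. -/
noncomputable def err [∀ t, MetricSpace (E t)] (e : ∀ i, E i) (t : ℕ) : ℝ :=
  min (dist (e t) (S.prediction t)) (S.c / S.b)

/-- The competitive ratio of a complete batch whose predictions are correct. -/
noncomputable def batchRatio : ℝ := S.γ * S.α / (S.α + S.γ)

theorem errorThreshold_eq : S.errorThreshold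
    = S.batchRatio / (S.η - 15 / 16 * S.ε) * (5 * S.α * S.c / S.b) := by
  rw [errorThreshold, batchRatio, div_div, mul_comm (S.η - 15 / 16 * S.ε)]

theorem err_le [∀ t, MetricSpace (E t)] (e : ∀ i, E i) (t : ℕ) : S.err e t ≤ S.c / S.b := min_le_right _ _

/-- The assumptions on the problem, the oracles and the parameters. -/
structure IsValid [∀ t, MetricSpace (E t)] (v f : ℝ) : Prop where
  lipschitz : P.StronglyLipschitz S.b v
  influence : P.BoundedInfluence f
  offline : P.IsOfflineOracle S.γ S.offline
  online : P.IsOnlineOracle S.η f S.online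
  est : P.IsEffLengthEstimator S.est
  fallback : ∀ t, Measurable (S.fallback t)
  prediction : P.IsFinite S.prediction
  L_pos : 0 < P.L
  γ_pos : 0 < S.γ
  γ_le : S.γ ≤ 1
  η_le : S.η ≤ 1
  ε_pos : 0 < S.ε
  ε_lt : S.ε < S.η
  b_ge : 1 ≤ S.b
  b_le : S.b ≤ S.c
  v_le : v ≤ S.c
  f_le : f ≤ S.c
  α_ge : 3 ≤ S.α
  ratio : S.η - 15 * S.ε / 16 ≤ S.batchRatio
  H_pos : 0 < S.H

namespace IsValid

variable {S} [∀ t, MetricSpace (E t)] {v f : ℝ} (h : S.IsValid v f)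
include h

theorem b_pos : 0 < S.b := by linarith [h.b_ge]

theorem c_ge : 1 ≤ S.c := h.b_ge.trans h.b_le

theorem c_pos : 0 < S.c := by linarith [h.c_ge]

theorem α_pos : 0 < S.α := by linarith [h.α_ge]

theorem η_pos : 0 < S.η := h.ε_pos.trans h.ε_lt

theorem batchRatio_pos : 0 < S.batchRatio := by
  have := h.γ_pos; have := h.α_pos
  unfold batchRatio; positivity

theorem batchRatio_le_γ : S.batchRatio ≤ S.γ := by
  have h1 := h.γ_pos; have h2 := h.α_pos
  unfold batchRatio
  rw [div_le_iff₀ (by positivity)]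
  nlinarith

theorem batchRatio_le_one : S.batchRatio ≤ 1 := h.batchRatio_le_γ.trans h.γ_le

theorem batchGoal_pos : 0 < S.α * S.c * P.L := by
  have := h.α_pos; have := h.c_pos; have := h.L_pos
  positivity

theorem ρ_pos : 0 < S.η - 15 / 16 * S.ε := by linarith [h.ε_lt, h.ε_pos]

theorem errorThreshold_pos : 0 < S.errorThreshold := by
  have := h.α_pos; have := h.c_pos; have := h.b_pos; have := h.batchRatio_pos; have := h.ρ_pos
  rw [S.errorThreshold_eq]
  positivity

theorem err_nonneg (e : ∀ i, E i) (t : ℕ) : 0 ≤ S.err e t := by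
  have := h.c_pos; have := h.b_pos
  exact le_min dist_nonneg (by positivity)

theorem sum_err_nonneg (e : ∀ i, E i) (s : Finset ℕ) : 0 ≤ ∑ i ∈ s, S.err e i :=
  sum_nonneg fun i _ => h.err_nonneg e i

/-- Since v ≤ c, min(b d, v) ≤ min(b d, c) = b min(d, c/b), which is why errors truncated at c/b
suffice. -/
theorem abs_val_sub_le {e : ∀ i, E i} (t w : ℕ) (a : ∀ i, A i) :
    |P.val t w e a - P.val t w (splice (t + 1) e S.prediction) a|
      ≤ S.b * P.L * ∑ k ∈ Ico t w, S.err e k := by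
  have hnn : 0 ≤ S.b * P.L := mul_nonneg h.b_pos.le h.L_pos.le
  rcases le_or_gt (t + 1) w with hw | hw
  · have h1 := h.lipschitz.abs_val_sub_splice_le (e := e) h.prediction (Nat.le_succ t) hw le_rfl a
    have h2 : P.val t w (splice w e S.prediction) a = P.val t w e a :=
      P.val_congr (fun i hi => splice_of_lt hi _ _) fun _ _ => rfl
    rw [h2] at h1
    refine h1.trans ?_
    rw [mul_comm S.b, mul_assoc]
    refine mul_le_mul_of_nonneg_left ?_ h.L_pos.le
    rw [mul_sum]
    calc ∑ k ∈ Ico (t + 1) w, min (S.b * dist (e k) (S.prediction k)) v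
        ≤ ∑ k ∈ Ico (t + 1) w, S.b * S.err e k := by
          refine sum_le_sum fun k _ => ?_
          have hb := h.b_pos
          rw [err, mul_min_of_nonneg _ _ hb.le, mul_div_cancel₀ _ hb.ne']
          exact min_le_min_left _ h.v_le
      -- Request `t` is already observed and contributes no error; its term is added so that the
      -- sums of consecutive batches concatenate.
      _ ≤ ∑ k ∈ Ico t w, S.b * S.err e k :=
          sum_le_sum_of_subset_of_nonneg (Ico_subset_Ico_left (Nat.le_succ t))
            fun k _ _ => mul_nonneg h.b_pos.le (h.err_nonneg e k)
  · rw [P.val_eq_zero (by omega), P.val_eq_zero (by omega)]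
    simpa using mul_nonneg hnn (h.sum_err_nonneg e _)

theorem maxVal_le_opt [∀ t, Nonempty (A t)] {e : ∀ i, E i} (he : P.IsFinite e) (t w : ℕ) (a : ∀ i, A i) :
    P.maxVal t w e ≤ P.opt t w (splice (t + 1) e S.prediction) a
      + S.b * P.L * ∑ k ∈ Ico t w, S.err e k + S.c * P.L := by
  have h1 := h.influence.maxVal_le he t w a
  have h2 : P.opt t w e a ≤ P.opt t w (splice (t + 1) e S.prediction) a
      + S.b * P.L * ∑ k ∈ Ico t w, S.err e k := by
    refine ciSup_le fun a' => ?_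
    have h3 := (abs_le.1 (h.abs_val_sub_le (e := e) t w (splice t a a'))).2
    have h4 := P.val_le_opt t w (splice (t + 1) e S.prediction) a a'
    linarith
  have h5 := mul_le_mul_of_nonneg_right h.f_le h.L_pos.le
  linarith

/-- Loop invariant: every rejected end `w` had an oracle plan worth less than the goal, so γ times
its optimum is below the goal too. The initial fallback plan carries no guarantee and needs none,
its window being empty. -/
theorem extendBatch_spec (t : ℕ) {e' : ∀ i, E i} (he' : P.IsFinite e') (a : ∀ i, A i) (k q : ℕ)
    (x : ∀ i, A i) (hq : t ≤ q) (hx : q = t ∨ x = S.offline.plan t q e' a)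
    (hw : ∀ w : ℕ, w < q → S.γ * P.opt t w e' a ≤ S.α * S.c * P.L) :
    t ≤ (S.extendBatch t e' a k q x).1 ∧
    S.γ * P.opt t (S.extendBatch t e' a k q x).1 e' a
      ≤ P.val t (S.extendBatch t e' a k q x).1 e' (splice t a (S.extendBatch t e' a k q x).2) ∧
    (∀ w : ℕ, w < (S.extendBatch t e' a k q x).1 →
      S.γ * P.opt t w e' a ≤ S.α * S.c * P.L) ∧
    ((S.extendBatch t e' a k q x).1 = q + k ∨ S.α * S.c * P.L
      ≤ P.val t (S.extendBatch t e' a k q x).1 e' (splice t a (S.extendBatch t e' a k q x).2)) := by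
  have hγ : S.γ * P.opt t q e' a ≤ P.val t q e' (splice t a x) := by
    rcases hq.eq_or_lt with rfl | hlt
    · rw [P.opt_eq_zero le_rfl, mul_zero]; exact P.val_nonneg _ _ _ _
    · rcases hx with rfl | rfl
      · exact absurd hlt (lt_irrefl _)
      · exact h.offline t q (by exact_mod_cast hlt) e' a he'
  induction k generalizing q x with
  | zero => exact ⟨hq, hγ, hw, Or.inl rfl⟩
  | succ k ih =>
    rw [extendBatch]
    split_ifs with hc
    · have := ih (q + 1) (S.offline.plan t ((q + 1 : ℕ) : ℕ∞) e' a) (by omega) (Or.inr rfl)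
        (fun w hlt => by
          rcases Nat.lt_succ_iff_lt_or_eq.1 hlt with h1 | rfl
          · exact hw w h1
          · exact hγ.trans hc.le)
        (h.offline t ((q + 1 : ℕ) : ℕ∞) (by exact_mod_cast Nat.lt_succ_of_le hq) e' a he')
      rwa [show q + (k + 1) = q + 1 + k by ring]
    · exact ⟨hq, hγ, hw, Or.inr (not_lt.1 hc)⟩

/-- A batch is as short as the oracle can make it, so before its end the optimum is small; at its
end both lower bounds on the planned reward hold. -/
theorem startBatch_spec (e : ∀ i, E i) (t : ℕ) (a : ∀ i, A i) :
    (∀ w : ℕ, (w : ℕ∞) < (S.startBatch t e a).1 →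
      S.γ * P.opt t w (splice (t + 1) e S.prediction) a ≤ S.α * S.c * P.L) ∧
    (∀ w : ℕ, (w : ℕ∞) = (S.startBatch t e a).1 → t < w ∧
      S.α * S.c * P.L ≤ P.val t w (splice (t + 1) e S.prediction)
        (splice t a (S.startBatch t e a).2) ∧
      S.γ * P.opt t w (splice (t + 1) e S.prediction) a
        ≤ P.val t w (splice (t + 1) e S.prediction) (splice t a (S.startBatch t e a).2)) := by
  have hfin : P.IsFinite (splice (t + 1) e S.prediction) := h.prediction.splice _ _
  have hD := h.batchGoal_pos
  obtain ⟨h1, h2, h3, h4⟩ := h.extendBatch_spec t hfin a (S.est (t + 1) e S.prediction - t) t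
    (S.fallback t a) le_rfl (Or.inl rfl) (fun w hw => by
      rw [P.opt_eq_zero hw.le, mul_zero]; exact hD.le)
  unfold startBatch
  simp only
  set r := S.extendBatch t (splice (t + 1) e S.prediction) a (S.est (t + 1) e S.prediction - t) t
    (S.fallback t a)
  split_ifs with hc
  · refine ⟨fun w _ => ?_, fun w hw => absurd hw (by simp)⟩
    have hr : r.1 = t + (S.est (t + 1) e S.prediction - t) := h4.resolve_right (not_le.2 hc)
    have hle := h2.trans hc.le
    rcases lt_or_ge w r.1 with hw | hw
    · exact h3 w hw
    -- The failed loop ran up to the estimated effective length, after which the optimum no longer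
    -- grows.
    · have hor : P.IsHorizon (splice (t + 1) e S.prediction) r.1 :=
        (Problem.isHorizon_of_effLength_le (h.est.le (t + 1) e _ h.prediction)).mono (by omega)
      rwa [hor.opt_eq hw]
  · refine ⟨fun w hw => h3 w (Nat.cast_lt.1 hw), fun w hw => ?_⟩
    have hw' : w = r.1 := Nat.cast_injective hw
    subst hw'
    refine ⟨lt_of_le_of_ne h1 fun heq => ?_, not_lt.1 hc, h2⟩
    rw [P.val_eq_zero heq.ge] at hc
    exact hc hD

/-- The loss of a batch relative to `κ` times the optimum. -/
theorem batch_loss [∀ t, Nonempty (A t)] {e : ∀ i, E i} (he : P.IsFinite e) (t : ℕ) (a : ∀ i, A i) {κ : ℝ} (hκ0 : 0 ≤ κ)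
    (hκ : κ ≤ S.batchRatio) (w : ℕ) (hw : (w : ℕ∞) ≤ (S.startBatch t e a).1) :
    κ * P.maxVal t w e - κ * (1 + 1 / S.batchRatio) * (S.b * P.L) * ∑ i ∈ Ico t w, S.err e i
      - (if (w : ℕ∞) = (S.startBatch t e a).1 then 0 else S.α * S.c * P.L + S.c * P.L)
      ≤ P.val t w e (splice t a (S.startBatch t e a).2) := by
  obtain ⟨h1, h2⟩ := h.startBatch_spec e t a
  have h3 := h.maxVal_le_opt he t w a
  have h4 := (abs_le.1 (h.abs_val_sub_le (e := e) t w (splice t a (S.startBatch t e a).2))).1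
  have h5 := P.val_nonneg t w e (splice t a (S.startBatch t e a).2)
  have hr := h.batchRatio_pos
  have hγ := h.γ_pos
  have hα := h.α_pos
  have hcL : 0 < S.c * P.L := mul_pos h.c_pos h.L_pos
  have hΦ : 0 ≤ S.b * P.L * ∑ i ∈ Ico t w, S.err e i :=
    mul_nonneg (mul_nonneg h.b_pos.le h.L_pos.le) (h.sum_err_nonneg e _)
  set V := P.val t w (splice (t + 1) e S.prediction) (splice t a (S.startBatch t e a).2)
  set O := P.opt t w (splice (t + 1) e S.prediction) a
  set Φ := S.b * P.L * ∑ i ∈ Ico t w, S.err e i with hΦd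
  set r := S.batchRatio with hrd
  have h6 : κ * P.maxVal t w e ≤ κ * (O + Φ + S.c * P.L) := mul_le_mul_of_nonneg_left h3 hκ0
  have h7 : κ * (1 + 1 / r) * (S.b * P.L) * ∑ i ∈ Ico t w, S.err e i = κ * Φ + κ / r * Φ := by
    rw [hΦd]; ring
  rw [h7]
  have hκr : κ / r ≤ 1 := by rwa [div_le_one hr]
  have hκr0 : 0 ≤ κ / r := by positivity
  split_ifs with hwn
  · obtain ⟨-, h8, h9⟩ := h2 w hwn
    -- Adding α V ≥ α γ O and γ V ≥ γ α c L: a completed batch absorbs the bounded-influence loss.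
    have h10 : r * (O + S.c * P.L) ≤ V := by
      rw [hrd, batchRatio, div_mul_eq_mul_div, div_le_iff₀ (by positivity)]
      nlinarith
    have h11 : κ * (O + S.c * P.L) ≤ κ / r * V := by
      calc κ * (O + S.c * P.L) = κ / r * (r * (O + S.c * P.L)) := by field_simp
        _ ≤ κ / r * V := by gcongr
    -- The realised reward is at least V - Φ and nonnegative, so scaling by κ / r ≤ 1 is safe
    -- whatever the sign of V - Φ. The error enters a second time through the optimum, giving the
    -- factor κ (1 + 1/r).
    have h12 : κ / r * (V - Φ) ≤ P.val t w e (splice t a (S.startBatch t e a).2) := by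
      rcases le_total (V - Φ) 0 with h0 | h0
      · exact (mul_nonpos_of_nonneg_of_nonpos hκr0 h0).trans h5
      · exact (mul_le_of_le_one_left h0 hκr).trans (by linarith)
    linarith
  · have h8 := h1 w (lt_of_le_of_ne hw hwn)
    have hO : 0 ≤ O := P.opt_nonneg _ _ _ _
    have h9 : κ * O ≤ S.γ * O := mul_le_mul_of_nonneg_right (hκ.trans h.batchRatio_le_γ) hO
    have h10 : κ * (S.c * P.L) ≤ S.c * P.L :=
      mul_le_of_le_one_left hcL.le (hκ.trans h.batchRatio_le_one)
    have h11 : 0 ≤ κ / r * Φ := mul_nonneg hκr0 hΦ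
    linarith

end IsValid

section Run

variable [∀ t, MetricSpace (E t)] (hfb : ∀ t, Measurable (S.fallback t)) (e : ∀ i, E i)
include hfb

open Classical in
theorem valueToGo_predictive (k t : ℕ) (q : ℕ∞) (φ : ℝ) (p a : ∀ i, A i)
    (batch : ℕ∞ × (∀ i, A i))
    (hb : batch = if (t : ℕ∞) = q then S.startBatch t e a else (q, p)) :
    S.valueToGo e (k + 1) t (.predictive q, φ, p, a)
      = P.reward t e (Function.update a t (batch.2 t)) + S.valueToGo e k (t + 1)
        (if S.errorThreshold ≤ φ + S.err e t then .conservative (t + 1) else .predictive batch.1,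
          φ + S.err e t, batch.2, Function.update a t (batch.2 t)) := by
  have hm := (measurable_reward_memory (P := P) e t).add (S.measurable_valueToGo e hfb k (t + 1))
  rw [valueToGo, step, ← hb]
  unfold err
  split_ifs with h1
  all_goals exact integral_dirac' _ _ hm.stronglyMeasurable

/-- The run of a batch until the horizon, its end, or the switch to the conservative state. -/
theorem exists_run (N : ℕ) (n : ℕ∞) (x y : ∀ i, A i) (h0 : ∀ t, 0 ≤ S.err e t)
    (hδ : ∀ t, S.err e t ≤ S.c / S.b)    (k s : ℕ) (hsN : s + k = N) (hsn : (s : ℕ∞) ≤ n) (hxy : ∀ i ≥ s, x i = y i) (φ : ℝ)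
    (a : ∀ i, A i) (hay : ∀ i < s, a i = y i) (hφ : φ < S.errorThreshold) :
    ∃ w a', s ≤ w ∧ w ≤ N ∧ (w : ℕ∞) ≤ n ∧
      φ + ∑ i ∈ Ico s w, S.err e i < S.errorThreshold + S.c / S.b ∧
      ((w = N ∧ S.valueToGo e k s (.predictive n, φ, x, a) = P.val s w e y) ∨
       ((w : ℕ∞) = n ∧ φ + ∑ i ∈ Ico s w, S.err e i < S.errorThreshold ∧
          S.valueToGo e k s (.predictive n, φ, x, a) = P.val s w e y
            + S.valueToGo e (N - w) w (.predictive w, φ + ∑ i ∈ Ico s w, S.err e i, x, a')) ∨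
       (s < w ∧ S.errorThreshold ≤ φ + ∑ i ∈ Ico s w, S.err e i ∧
          S.valueToGo e k s (.predictive n, φ, x, a) = P.val s w e y
            + S.valueToGo e (N - w) w
              (.conservative w, φ + ∑ i ∈ Ico s w, S.err e i, x, a'))) := by
  induction k generalizing s φ a with
  | zero =>
    refine ⟨s, a, le_rfl, by omega, hsn, ?_, Or.inl ⟨hsN, ?_⟩⟩
    · have := (h0 s).trans (hδ s)
      simp only [Ico_self, sum_empty]
      linarith
    · rw [P.val_eq_zero le_rfl]; rfl
  | succ k ih =>
    by_cases hn : (s : ℕ∞) = n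
    · refine ⟨s, a, le_rfl, by omega, hsn, ?_, Or.inr (Or.inl ⟨hn, by simpa, ?_⟩)⟩
      · have := (h0 s).trans (hδ s)
        simp only [Ico_self, sum_empty]
        linarith
      · rw [P.val_eq_zero le_rfl, ← hn, show N - s = k + 1 by omega]
        simp
    · have hstep := S.valueToGo_predictive hfb e k s n φ x a (n, x) (by rw [if_neg hn])
      have hup : ∀ i < s + 1, Function.update a s (x s) i = y i := by
        intro i hi
        rcases Nat.lt_succ_iff_lt_or_eq.1 hi with h1 | rfl
        · rw [Function.update_of_ne h1.ne, hay i h1]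
        · rw [Function.update_self, hxy i le_rfl]
      have hrew : P.reward s e (Function.update a s (x s)) = P.reward s e y :=
        P.reward_congr s e e _ _ (fun _ _ => rfl) fun i hi => hup i (Nat.lt_succ_of_le hi)
      simp only [hrew] at hstep
      have hval : ∀ w : ℕ, s < w → P.val s w e y = P.reward s e y + P.val (s + 1) w e y := by
        intro w hw
        rw [P.val_coe, P.val_coe, sum_eq_sum_Ico_succ_bot hw]
      have hsum : ∀ w : ℕ, s < w → φ + ∑ i ∈ Ico s w, S.err e i
          = φ + S.err e s + ∑ i ∈ Ico (s + 1) w, S.err e i := by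
        intro w hw
        rw [sum_eq_sum_Ico_succ_bot hw, add_assoc]
      have hsn' : ((s + 1 : ℕ) : ℕ∞) ≤ n := by
        push_cast
        exact Order.add_one_le_of_lt (lt_of_le_of_ne hsn hn)
      by_cases hc : S.errorThreshold ≤ φ + S.err e s
      · rw [if_pos hc] at hstep
        refine ⟨s + 1, Function.update a s (x s), by omega, by omega, hsn', ?_,
          Or.inr (Or.inr ⟨by omega, ?_, ?_⟩)⟩
        · have := hδ s
          rw [hsum _ (by omega), Ico_self, sum_empty]
          linarith
        · rw [hsum _ (by omega), Ico_self, sum_empty, add_zero]; exact hc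
        · rw [hstep, hval _ (by omega), hsum _ (by omega), P.val_eq_zero le_rfl, Ico_self,
            sum_empty, show N - (s + 1) = k by omega, add_zero, add_zero]
      · rw [if_neg hc] at hstep
        obtain ⟨w, a', h1, h2, h3, h4, h5⟩ := ih (s + 1) (by omega) hsn'
          (fun i hi => hxy i (by omega)) (φ + S.err e s) (Function.update a s (x s)) hup
          (not_le.1 hc)
        have hsw : s < w := h1
        rw [← hsum w hsw] at h4 h5
        refine ⟨w, a', hsw.le, h2, h3, h4, ?_⟩
        rw [hstep, hval w hsw]
        rcases h5 with ⟨h6, h7⟩ | ⟨h6, h7, h8⟩ | ⟨h6, h7, h8⟩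
        · exact Or.inl ⟨h6, by rw [h7]⟩
        · exact Or.inr (Or.inl ⟨h6, h7, by rw [h8, add_assoc]⟩)
        · exact Or.inr (Or.inr ⟨hsw, h7, by rw [h8, add_assoc]⟩)

end Run

namespace IsValid

variable {S} [∀ t, MetricSpace (E t)] {v f : ℝ} (h : S.IsValid v f)
include h

/-- The first period computes the batch and is treated apart; afterwards `exists_run` follows a
fixed plan. The accumulated error overshoots its threshold by less than one truncated error c/b. -/
theorem exists_batch_run (e : ∀ i, E i) {N t : ℕ} (htN : t < N) (φ : ℝ) (p a : ∀ i, A i)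
    (hφ : φ < S.errorThreshold) :
    ∃ w x a', t < w ∧ w ≤ N ∧ (w : ℕ∞) ≤ (S.startBatch t e a).1 ∧
      φ + ∑ i ∈ Ico t w, S.err e i < S.errorThreshold + S.c / S.b ∧
      ((w = N ∧ S.valueToGo e (N - t) t (.predictive t, φ, p, a)
          = P.val t w e (splice t a (S.startBatch t e a).2)) ∨
       ((w : ℕ∞) = (S.startBatch t e a).1 ∧ φ + ∑ i ∈ Ico t w, S.err e i < S.errorThreshold ∧
          S.valueToGo e (N - t) t (.predictive t, φ, p, a)
            = P.val t w e (splice t a (S.startBatch t e a).2)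
            + S.valueToGo e (N - w) w (.predictive w, φ + ∑ i ∈ Ico t w, S.err e i, x, a')) ∨
       (S.errorThreshold ≤ φ + ∑ i ∈ Ico t w, S.err e i ∧
          S.valueToGo e (N - t) t (.predictive t, φ, p, a)
            = P.val t w e (splice t a (S.startBatch t e a).2)
            + S.valueToGo e (N - w) w
              (.conservative w, φ + ∑ i ∈ Ico t w, S.err e i, x, a'))) := by
  obtain ⟨k, hk⟩ : ∃ k, N - t = k + 1 := ⟨N - t - 1, by omega⟩
  have hstep := S.valueToGo_predictive h.fallback e k t t φ p a (S.startBatch t e a) (by simp)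
  rw [← hk] at hstep
  obtain ⟨hb1, hb2⟩ := h.startBatch_spec e t a
  set n := (S.startBatch t e a).1
  set x := (S.startBatch t e a).2
  set y := splice t a x
  have hup : ∀ i < t + 1, Function.update a t (x t) i = y i := by
    intro i hi
    rcases Nat.lt_succ_iff_lt_or_eq.1 hi with h1 | rfl
    · exact (Function.update_of_ne h1.ne _ _).trans (splice_of_lt h1 _ _).symm
    · exact (Function.update_self _ _ _).trans (splice_of_le le_rfl _ _).symm
  have hrew : P.reward t e (Function.update a t (x t)) = P.reward t e y :=
    P.reward_congr t e e _ _ (fun _ _ => rfl) fun i hi => hup i (Nat.lt_succ_of_le hi)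
  have hval : ∀ w : ℕ, t < w → P.val t w e y = P.reward t e y + P.val (t + 1) w e y := by
    intro w hw
    rw [P.val_coe, P.val_coe, sum_eq_sum_Ico_succ_bot hw]
  have hsum : ∀ w : ℕ, t < w → φ + ∑ i ∈ Ico t w, S.err e i
      = φ + S.err e t + ∑ i ∈ Ico (t + 1) w, S.err e i := by
    intro w hw
    rw [sum_eq_sum_Ico_succ_bot hw, add_assoc]
  have htn : ((t + 1 : ℕ) : ℕ∞) ≤ n := by
    rcases le_or_gt ((t + 1 : ℕ) : ℕ∞) n with hle | hlt
    · exact hle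
    · exfalso
      obtain ⟨m, hm⟩ := ENat.ne_top_iff_exists.1 hlt.ne_top
      rw [← hm] at hlt
      have h1 := (hb2 m hm).1
      have h2 : m < t + 1 := Nat.cast_lt.1 hlt
      omega
  rw [hrew] at hstep
  by_cases hc : S.errorThreshold ≤ φ + S.err e t
  · rw [if_pos hc] at hstep
    refine ⟨t + 1, x, Function.update a t (x t), by omega, by omega, htn, ?_,
      Or.inr (Or.inr ⟨?_, ?_⟩)⟩
    · have := S.err_le e t
      rw [hsum _ (by omega), Ico_self, sum_empty]
      linarith
    · rw [hsum _ (by omega), Ico_self, sum_empty, add_zero]; exact hc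
    · rw [hstep, hval _ (by omega), hsum _ (by omega), P.val_eq_zero le_rfl, Ico_self,
        sum_empty, show N - (t + 1) = k by omega, add_zero, add_zero]
  · rw [if_neg hc] at hstep
    obtain ⟨w, a', h1, h2, h3, h4, h5⟩ := S.exists_run h.fallback e N n x y (h.err_nonneg e)
      (S.err_le e) k (t + 1) (by omega) htn (fun i hi => (splice_of_le (by omega) _ _).symm)
      (φ + S.err e t) (Function.update a t (x t)) hup (not_le.1 hc)
    have htw : t < w := h1
    rw [← hsum w htw] at h4 h5
    refine ⟨w, x, a', htw, h2, h3, h4, ?_⟩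
    rw [hstep, hval w htw]
    rcases h5 with ⟨h6, h7⟩ | ⟨h6, h7, h8⟩ | ⟨h6, h7, h8⟩
    · exact Or.inl ⟨h6, by rw [h7]⟩
    · exact Or.inr (Or.inl ⟨h6, h7, by rw [h8, add_assoc]⟩)
    · exact Or.inr (Or.inr ⟨h7, by rw [h8, add_assoc]⟩)

/-- A lower bound for the predictive state, given one for the conservative state. -/
theorem predictive_bound [∀ t, Nonempty (A t)] {e : ∀ i, E i} (he : P.IsFinite e) {N : ℕ}
    {κ : ℝ} (hκ0 : 0 ≤ κ) (hκ : κ ≤ S.batchRatio) (B : ℕ → ℝ) (g : ℕ → ℝ → ℝ) (t₀ : ℕ)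
    (hcons : ∀ w ≤ N, t₀ < w → ∀ φ p a,
      κ * P.maxVal w N e - B w ≤ S.valueToGo e (N - w) w (.conservative w, φ, p, a))
    (hcont : ∀ t w φ, t < w → w ≤ N → φ + ∑ i ∈ Ico t w, S.err e i < S.errorThreshold →
      κ * (1 + 1 / S.batchRatio) * (S.b * P.L) * ∑ i ∈ Ico t w, S.err e i
        + g w (φ + ∑ i ∈ Ico t w, S.err e i) ≤ g t φ)
    (hswitch : ∀ t w φ, t < w → w ≤ N → S.errorThreshold ≤ φ + ∑ i ∈ Ico t w, S.err e i →
      φ + ∑ i ∈ Ico t w, S.err e i < S.errorThreshold + S.c / S.b →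
      κ * (1 + 1 / S.batchRatio) * (S.b * P.L) * ∑ i ∈ Ico t w, S.err e i + B w ≤ g t φ)
    (hend : ∀ t φ, t ≤ N → 0 ≤ φ →
      φ + ∑ i ∈ Ico t N, S.err e i < S.errorThreshold + S.c / S.b →
      κ * (1 + 1 / S.batchRatio) * (S.b * P.L) * ∑ i ∈ Ico t N, S.err e i ≤ g t φ)
    (t : ℕ) (ht₀ : t₀ ≤ t) (htN : t ≤ N) (φ : ℝ) (hφ0 : 0 ≤ φ) (hφ : φ < S.errorThreshold)
    (p a : ∀ i, A i) :
    κ * P.maxVal t N e - (S.α * S.c * P.L + S.c * P.L) - g t φ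
      ≤ S.valueToGo e (N - t) t (.predictive t, φ, p, a) := by
  have hcL : 0 < S.c * P.L := mul_pos h.c_pos h.L_pos
  have hD := h.batchGoal_pos
  have hcb : 0 < S.c / S.b := div_pos h.c_pos h.b_pos
  induction hk : N - t using Nat.strong_induction_on generalizing t φ p a with
  | _ k ih =>
    subst hk
    rcases htN.eq_or_lt with rfl | htN
    · have h1 := hend t φ le_rfl hφ0 (by simp only [Ico_self, sum_empty]; linarith)
      rw [Ico_self, sum_empty, mul_zero] at h1
      rw [P.maxVal_eq_zero le_rfl]
      exact le_trans (by linarith) (S.valueToGo_nonneg e _ _ _)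
    · obtain ⟨w, x, a', h1, h2, h3, h4, h5⟩ := h.exists_batch_run e htN φ p a hφ
      have hloss := h.batch_loss he t a hκ0 hκ w h3
      have hsub := mul_le_mul_of_nonneg_left (P.maxVal_add_le h1.le h2 e) hκ0
      rw [mul_add] at hsub
      have hΦ := h.sum_err_nonneg e (Ico t w)
      -- The three outcomes are horizon, completed batch and switch. Completed batches lose nothing
      -- but errors, so the single allowance α c L + c L survives until the last batch of the phase.
      rcases h5 with ⟨rfl, h6⟩ | ⟨h6, h7, h8⟩ | ⟨h7, h8⟩
      · have h9 := hend t φ htN.le hφ0 h4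
        rw [h6]
        split_ifs at hloss <;> linarith
      · have h9 := hcont t w φ h1 h2 h7
        have h10 := ih (N - w) (by omega) w (by omega) h2 (φ + ∑ i ∈ Ico t w, S.err e i)
          (by linarith) h7 x a' rfl
        rw [h8]
        rw [if_pos h6] at hloss
        linarith
      · have h9 := hswitch t w φ h1 h2 h7 h4
        have h10 := hcons w h2 (by omega) (φ + ∑ i ∈ Ico t w, S.err e i) x a'
        rw [h8]
        split_ifs at hloss <;> linarith

end IsValid

end AdaSwitch

end OnlineDecision

/-! ### One conservative period and the accuracy of the switching test. -/

namespace OnlineDecision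

open Finset

variable {E : ℕ → Type uE} {A : ℕ → Type uA} [∀ t, MeasurableSpace (A t)]

namespace AdaSwitch

variable {P : Problem E A} (S : AdaSwitch P)

theorem integral_add_add {α : Type*} [MeasurableSpace α] {μ : Measure α} {f g h : α → ℝ}
    (hf : Integrable f μ) (hg : Integrable g μ) (hh : Integrable h μ) :
    ∫ x, (f x + g x + h x) ∂μ = ∫ x, f x ∂μ + ∫ x, g x ∂μ + ∫ x, h x ∂μ := by
  rw [← integral_add hf hg]
  exact integral_add (hf.add hg) hh

/-- The expected reward in period `τ + j` of the policy started in period `τ`. -/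
noncomputable def policyReward (e : ∀ i, E i) (τ : ℕ) (a : ∀ i, A i) (j : ℕ) : ℝ :=
  ∫ x, P.reward (τ + j) e x ∂((S.online τ).law e τ a (j + 1))

/-- The probability that a conservative state entered at period `τ` and lasting until period `t` is
left after that period. -/
noncomputable def stopProb (e : ∀ i, E i) (τ t : ℕ) (a : ∀ i, A i) : ℝ :=
  (P.monteCarlo (S.online τ) e τ ((t + 1 : ℕ)) (S.H * (t + 1) ^ 5) a).real
    {s | S.rewardThreshold ≤ s}

theorem stopProb_nonneg (e : ∀ i, E i) (τ t : ℕ) (a : ∀ i, A i) : 0 ≤ S.stopProb e τ t a :=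
  measureReal_nonneg

theorem stopProb_le_one (e : ∀ i, E i) (τ t : ℕ) (a : ∀ i, A i) : S.stopProb e τ t a ≤ 1 :=
  measureReal_le_one

theorem policyReward_nonneg (e : ∀ i, E i) (τ : ℕ) (a : ∀ i, A i) (j : ℕ) :
    0 ≤ S.policyReward e τ a j :=
  integral_nonneg fun _ => P.reward_nonneg _ _ _

theorem policyReward_le (e : ∀ i, E i) (τ : ℕ) (a : ∀ i, A i) (j : ℕ) :
    S.policyReward e τ a j ≤ P.L :=
  (le_abs_self _).trans (abs_integral_le_of_abs_le fun _ => P.abs_reward_le _ _ _)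

section Conservative

variable [∀ t, MetricSpace (E t)] (hfb : ∀ t, Measurable (S.fallback t)) (e : ∀ i, E i)
include hfb

/-- Action and estimate are independent, so the integral over their product factorises; `Y` bounds
the predictive continuation uniformly in the executed action. -/
theorem le_valueToGo_conservative (k t τ : ℕ) (φ : ℝ) (p x : ∀ i, A i) {Y : ℝ}
    (hY : ∀ a', Y ≤ S.valueToGo e k (t + 1) (.predictive (t + 1 : ℕ), 0, p, a')) :
    ∫ y, P.reward t e y ∂((S.online τ).extend e t x)
      + (1 - S.stopProb e τ t x)
        * ∫ y, S.valueToGo e k (t + 1) (.conservative τ, φ, p, y) ∂((S.online τ).extend e t x)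
      + S.stopProb e τ t x * Y
      ≤ S.valueToGo e (k + 1) t (.conservative τ, φ, p, x) := by
  classical
  set μ := (S.online τ).act t e x
  set ν := P.monteCarlo (S.online τ) e τ ((t + 1 : ℕ)) (S.H * (t + 1) ^ 5) x
  have hup := measurable_update (δ := ℕ) (X := A) x (a := t)
  have hgm := S.measurable_valueToGo e hfb k (t + 1)
  have hrm := P.measurable_reward t e
  let R : A t → ℝ := fun z => P.reward t e (Function.update x t z)
  let K : A t → ℝ := fun z =>
    S.valueToGo e k (t + 1) (.conservative τ, φ, p, Function.update x t z)
  let i : ℝ → ℝ := Set.indicator {s | S.rewardThreshold ≤ s} 1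
  have hset : MeasurableSet {s : ℝ | S.rewardThreshold ≤ s} := measurableSet_Ici
  have hR : Measurable R := hrm.comp hup
  have hK : Measurable K := hgm.comp (by fun_prop)
  have hi : Measurable i := measurable_one.indicator hset
  have hRb : ∀ z, |R z| ≤ P.L := fun z => P.abs_reward_le _ _ _
  have hKb : ∀ z, |K z| ≤ k * P.L := fun z => S.abs_valueToGo_le e _ _ _
  have hi01 : ∀ s, 0 ≤ i s ∧ i s ≤ 1 := by
    intro s
    by_cases hs : s ∈ {s : ℝ | S.rewardThreshold ≤ s}
    · simp [i, Set.indicator_of_mem hs]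
    · simp [i, Set.indicator_of_notMem hs]
  have hib : ∀ s, |i s| ≤ 1 := fun s => by rw [abs_of_nonneg (hi01 s).1]; exact (hi01 s).2
  have h1ib : ∀ s, |1 - i s| ≤ 1 := fun s => by
    rw [abs_of_nonneg (by linarith [(hi01 s).2])]; linarith [(hi01 s).1]
  have hq : ∫ s, i s ∂ν = S.stopProb e τ t x := integral_indicator_one hset
  have e1 : ∫ y, P.reward t e y ∂((S.online τ).extend e t x) = ∫ z, R z ∂μ :=
    integral_map hup.aemeasurable hrm.aestronglyMeasurable
  have e2 : ∫ y, S.valueToGo e k (t + 1) (.conservative τ, φ, p, y) ∂((S.online τ).extend e t x)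
      = ∫ z, K z ∂μ :=
    integral_map hup.aemeasurable
      (hgm.comp (g := S.valueToGo e k (t + 1)) (by fun_prop)).aestronglyMeasurable
  have iR : Integrable (fun z : A t × ℝ => R z.1) (μ.prod ν) :=
    integrable_of_abs_le (hR.comp measurable_fst) fun z => hRb z.1
  have iK : Integrable (fun z : A t × ℝ => K z.1 * (1 - i z.2)) (μ.prod ν) := by
    refine integrable_of_abs_le (C := k * P.L * 1) (by fun_prop) fun z => ?_
    rw [abs_mul]
    exact mul_le_mul (hKb _) (h1ib _) (abs_nonneg _) ((abs_nonneg _).trans (hKb z.1))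
  have iY : Integrable (fun z : A t × ℝ => i z.2 * Y) (μ.prod ν) := by
    refine integrable_of_abs_le (C := 1 * |Y|) (by fun_prop) fun z => ?_
    rw [abs_mul]
    exact mul_le_mul_of_nonneg_right (hib _) (abs_nonneg _)
  have hlow : ∫ z, (R z.1 + K z.1 * (1 - i z.2) + i z.2 * Y) ∂(μ.prod ν)
      = ∫ z, R z ∂μ + (1 - S.stopProb e τ t x) * ∫ z, K z ∂μ + S.stopProb e τ t x * Y := by
    rw [integral_add_add iR iK iY]
    congr 1
    · congr 1
      · rw [integral_fun_fst]; simp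
      · rw [integral_prod_mul K fun s => 1 - i s, integral_sub (integrable_const _)
          (integrable_of_abs_le hi hib), hq]
        simp [mul_comm]
    · rw [integral_mul_const, integral_fun_snd, hq]; simp
  rw [e1, e2, ← hlow, valueToGo, step]
  let F : A t × ℝ → Memory A := fun xs => if S.rewardThreshold ≤ xs.2 then
      (.predictive ((t + 1 : ℕ) : ℕ∞), 0, p, Function.update x t xs.1)
    else (.conservative τ, φ, p, Function.update x t xs.1)
  have hu : Measurable fun xs : A t × ℝ => Function.update x t xs.1 := hup.comp measurable_fst
  have hF : Measurable F :=
    Measurable.ite (measurableSet_le measurable_const measurable_snd) (by fun_prop) (by fun_prop)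
  have hG := (measurable_reward_memory (P := P) e t).add hgm
  have hmap := integral_map (μ := μ.prod ν) hF.aemeasurable hG.aestronglyMeasurable
  simp only [Pi.add_apply] at hmap
  refine le_of_le_of_eq ?_ hmap.symm
  refine integral_mono ((iR.add iK).add iY) (integrable_of_abs_le (C := P.L + k * P.L)
    (hG.comp hF) fun z => (abs_add_le _ _).trans
      (add_le_add (P.abs_reward_le _ _ _) (S.abs_valueToGo_le e _ _ _))) fun z => ?_
  by_cases hz : S.rewardThreshold ≤ z.2
  · have h1 : i z.2 = 1 := Set.indicator_of_mem (s := {s | S.rewardThreshold ≤ s}) hz 1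
    simp only [F, if_pos hz, h1, sub_self, mul_zero, add_zero, one_mul]
    exact add_le_add_right (hY _) _
  · have h1 : i z.2 = 0 := Set.indicator_of_notMem (s := {s | S.rewardThreshold ≤ s}) hz 1
    simp only [F, if_neg hz, h1, sub_zero, mul_one, zero_mul, add_zero]
    exact le_rfl

/-- The expected value to go if a conservative state entered at period `τ` has not been left in its
first `j` periods. -/
theorem le_integral_valueToGo_conservative (k τ j : ℕ) (φ : ℝ) (p a : ∀ i, A i) {Y : ℝ}
    (hY : ∀ a', Y ≤ S.valueToGo e k (τ + j + 1) (.predictive (τ + j + 1 : ℕ), 0, p, a')) :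
    S.policyReward e τ a j + (1 - S.stopProb e τ (τ + j) a)
        * ∫ y, S.valueToGo e k (τ + j + 1) (.conservative τ, φ, p, y)
            ∂((S.online τ).law e τ a (j + 1))
      + S.stopProb e τ (τ + j) a * Y
      ≤ ∫ x, S.valueToGo e (k + 1) (τ + j) (.conservative τ, φ, p, x)
          ∂((S.online τ).law e τ a j) := by
  set ℓ := (S.online τ).law e τ a j
  set q := S.stopProb e τ (τ + j) a
  set t := τ + j
  have hext := (S.online τ).measurable_extend e t
  have hrm := P.measurable_reward t e
  have hgm : Measurable fun y => S.valueToGo e k (t + 1) (.conservative τ, φ, p, y) :=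
    (S.measurable_valueToGo e hfb k (t + 1)).comp (by fun_prop)
  have hgm' : Measurable fun y => S.valueToGo e (k + 1) t (.conservative τ, φ, p, y) :=
    (S.measurable_valueToGo e hfb (k + 1) t).comp (by fun_prop)
  have hgb : ∀ y, |S.valueToGo e k (t + 1) (.conservative τ, φ, p, y)| ≤ k * P.L :=
    fun y => S.abs_valueToGo_le e _ _ _
  have hw1 := measurable_integral_of_measurable hext hrm
  have hw2 := measurable_integral_of_measurable hext hgm
  have hb1 : ∀ x, |∫ y, P.reward t e y ∂((S.online τ).extend e t x)| ≤ P.L := fun x =>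
    abs_integral_le_of_abs_le fun _ => P.abs_reward_le _ _ _
  have hb2 : ∀ x, |∫ y, S.valueToGo e k (t + 1) (.conservative τ, φ, p, y)
      ∂((S.online τ).extend e t x)| ≤ k * P.L := fun x => abs_integral_le_of_abs_le hgb
  have i1 : Integrable (fun x => ∫ y, P.reward t e y ∂((S.online τ).extend e t x)) ℓ :=
    integrable_of_abs_le hw1 hb1
  have i2 : Integrable (fun x => (1 - q) * ∫ y, S.valueToGo e k (t + 1) (.conservative τ, φ, p, y)
      ∂((S.online τ).extend e t x)) ℓ := (integrable_of_abs_le hw2 hb2).const_mul _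
  have e1 : S.policyReward e τ a j = ∫ x, ∫ y, P.reward t e y ∂((S.online τ).extend e t x) ∂ℓ :=
    integral_bind_of_abs_le hext (fun _ => inferInstance) hrm (P.abs_reward_le t e)
  have e2 : ∫ y, S.valueToGo e k (t + 1) (.conservative τ, φ, p, y)
        ∂((S.online τ).law e τ a (j + 1))
      = ∫ x, ∫ y, S.valueToGo e k (t + 1) (.conservative τ, φ, p, y)
        ∂((S.online τ).extend e t x) ∂ℓ :=
    integral_bind_of_abs_le hext (fun _ => inferInstance) hgm hgb
  have e3 : ∫ x, (∫ y, P.reward t e y ∂((S.online τ).extend e t x)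
      + (1 - q) * (∫ y, S.valueToGo e k (t + 1) (.conservative τ, φ, p, y)
        ∂((S.online τ).extend e t x)) + q * Y) ∂ℓ
      = S.policyReward e τ a j + (1 - q) * (∫ y, S.valueToGo e k (t + 1)
        (.conservative τ, φ, p, y) ∂((S.online τ).law e τ a (j + 1))) + q * Y := by
    rw [integral_add_add i1 i2 (integrable_const _), integral_const_mul,
      e1, e2]
    simp
  have hsp := (S.online τ).map_splice_law e τ j a
  rw [← e3]
  change ∫ x, _ ∂((S.online τ).law e τ a j) ≤ ∫ x, _ ∂((S.online τ).law e τ a j)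
  have hms := measurable_splice_right (X := A) τ a
  have hmW : Measurable fun x => ∫ y, P.reward t e y ∂((S.online τ).extend e t x)
      + (1 - q) * (∫ y, S.valueToGo e k (t + 1) (.conservative τ, φ, p, y)
        ∂((S.online τ).extend e t x)) + q * Y := (hw1.add (hw2.const_mul (1 - q))).add_const (q * Y)
  -- Viewing the law as its own image under `splice τ a` makes every trajectory agree with `a`
  -- before `τ` pointwise, so the switching probability is the constant `q`.
  rw [← hsp, integral_map hms.aemeasurable hgm'.aestronglyMeasurable,
    integral_map hms.aemeasurable hmW.aestronglyMeasurable]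
  refine integral_mono ?_ (integrable_of_abs_le (hgm'.comp hms) fun _ =>
    S.abs_valueToGo_le e _ _ _) fun x => ?_
  · have i3 := (i1.add i2).add (integrable_const (q * Y))
    have : Integrable (fun x => ∫ y, P.reward t e y ∂((S.online τ).extend e t x)
      + (1 - q) * (∫ y, S.valueToGo e k (t + 1) (.conservative τ, φ, p, y)
        ∂((S.online τ).extend e t x)) + q * Y) (((S.online τ).law e τ a j).map (splice τ a)) := by
      rw [hsp]; exact i3
    exact this.comp_measurable hms
  · have h := S.le_valueToGo_conservative hfb e k t τ φ p (splice τ a x) hY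
    have hq : S.stopProb e τ t (splice τ a x) = q := by
      simp only [q, stopProb]
      rw [P.monteCarlo_congr (S.online τ) e τ (τ + j + 1) _ (by omega) (a := a)
        (a' := splice τ a x) fun i hi => (splice_of_lt hi _ _).symm]
    rw [hq] at h
    exact h

end Conservative

/-- A bound for the probability of a wrong decision in period `t` caused by a Monte Carlo error. -/
noncomputable def errProb (t : ℕ) : ℝ :=
  64 * P.L ^ 2 / (S.rewardThreshold ^ 2 * ((t : ℝ) + 1) ^ 3)

theorem errProb_nonneg (t : ℕ) : 0 ≤ S.errProb t := by
  unfold errProb; positivity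

section MonteCarlo

variable (hH : 0 < S.H) (hT : 0 < S.rewardThreshold) (hL : 0 ≤ P.L) (e : ∀ i, E i) (τ j : ℕ)
  (a : ∀ i, A i)
include hH hT hL

/-- There are at least (t+1)⁵ samples, each at most (t+1) L, and the tolerance is T/16 for the
threshold T; the constant is 64 = 16²/4, and (t+1)²/(t+1)⁵ leaves the summable cube. -/
theorem monteCarlo_deviation_le :
    (P.monteCarlo (S.online τ) e τ ((τ + j + 1 : ℕ)) (S.H * (τ + j + 1) ^ 5) a).real
      {s | S.rewardThreshold / 16 ≤ |s - ∑ i ∈ range (j + 1), S.policyReward e τ a i|}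
      ≤ S.errProb (τ + j) := by
  have h := P.monteCarlo_abs_sub_ge_le (S.online τ) e τ (S.H * (τ + j + 1) ^ 5) (by positivity)
    (k := j + 1) a (δ := S.rewardThreshold / 16) (by positivity)
  refine h.trans ?_
  have hH1 : (1 : ℝ) ≤ S.H := by exact_mod_cast hH
  have hk : ((j + 1 : ℕ) : ℝ) ≤ ((τ + j : ℕ) : ℝ) + 1 := by push_cast; linarith [τ.cast_nonneg (α := ℝ)]
  have hpos : (0 : ℝ) < ((τ + j : ℕ) : ℝ) + 1 := by positivity
  have hN : (((τ + j : ℕ) : ℝ) + 1) ^ 5 ≤ ((S.H * (τ + j + 1) ^ 5 : ℕ) : ℝ) := by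
    push_cast
    exact le_mul_of_one_le_left (by positivity) hH1
  calc ((j + 1 : ℕ) * P.L) ^ 2 / (4 * ((S.H * (τ + j + 1) ^ 5 : ℕ) : ℝ)
        * (S.rewardThreshold / 16) ^ 2)
      ≤ ((((τ + j : ℕ) : ℝ) + 1) * P.L) ^ 2 / (4 * (((τ + j : ℕ) : ℝ) + 1) ^ 5
        * (S.rewardThreshold / 16) ^ 2) := by gcongr
    _ = S.errProb (τ + j) := by
      unfold errProb
      field_simp
      ring

theorem stopProb_le (hV : ∑ i ∈ range (j + 1), S.policyReward e τ a i
    ≤ 15 / 16 * S.rewardThreshold) : S.stopProb e τ (τ + j) a ≤ S.errProb (τ + j) := by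
  refine le_trans (measureReal_mono ?_) (S.monteCarlo_deviation_le hH hT hL e τ j a)
  intro s hs
  have hs' : S.rewardThreshold ≤ s := hs
  change _ ≤ |s - ∑ i ∈ range (j + 1), S.policyReward e τ a i|
  exact le_trans (by linarith) (le_abs_self _)

theorem one_sub_stopProb_le (hV : 17 / 16 * S.rewardThreshold
    ≤ ∑ i ∈ range (j + 1), S.policyReward e τ a i) :
    1 - S.stopProb e τ (τ + j) a ≤ S.errProb (τ + j) := by
  have hset : MeasurableSet {s : ℝ | S.rewardThreshold ≤ s} := measurableSet_Ici
  rw [stopProb, ← probReal_compl_eq_one_sub hset]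
  refine le_trans (measureReal_mono ?_) (S.monteCarlo_deviation_le hH hT hL e τ j a)
  intro s hs
  have hs' : s < S.rewardThreshold := not_le.1 hs
  change _ ≤ |s - ∑ i ∈ range (j + 1), S.policyReward e τ a i|
  exact le_trans (by linarith) (neg_le_abs _)

end MonteCarlo

end AdaSwitch

end OnlineDecision

/-! ### Conservative phases and the robust bound. -/

namespace OnlineDecision

open Finset

variable {E : ℕ → Type uE} {A : ℕ → Type uA} [∀ t, MeasurableSpace (A t)]

namespace AdaSwitch

variable {P : Problem E A} (S : AdaSwitch P)

/-- The reciprocal cubes are dominated by the telescoping terms 2/((t+1)(t+2)), of sum at most 2. -/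
theorem sum_errProb_le (N : ℕ) :
    ∑ t ∈ range N, S.errProb t ≤ 128 * P.L ^ 2 / S.rewardThreshold ^ 2 := by
  have h : ∀ n : ℕ, ∑ t ∈ range n, 1 / ((t : ℝ) + 1) ^ 3 ≤ 2 * (1 - 1 / ((n : ℝ) + 1)) := by
    intro n
    induction n with
    | zero => simp
    | succ n ih =>
      rw [sum_range_succ]
      have hn : (0 : ℝ) ≤ n := n.cast_nonneg
      have h1 : 1 / ((n : ℝ) + 1) ^ 3 ≤ 2 * (1 / (((n : ℝ) + 1) * (n + 2))) := by
        rw [mul_one_div, div_le_div_iff₀ (by positivity) (by positivity)]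
        nlinarith [mul_nonneg hn hn, mul_nonneg (mul_nonneg hn hn) hn]
      have h2 : 1 / (((n : ℝ) + 1) * (n + 2)) = 1 / ((n : ℝ) + 1) - 1 / ((n : ℝ) + 2) := by
        field_simp
        ring
      push_cast
      rw [add_assoc (n : ℝ), show (1 : ℝ) + 1 = 2 by norm_num]
      linarith
  have h2 : ∑ t ∈ range N, 1 / ((t : ℝ) + 1) ^ 3 ≤ 2 := by
    have : 0 ≤ 1 / ((N : ℝ) + 1) := by positivity
    linarith [h N]
  calc ∑ t ∈ range N, S.errProb t
      = 64 * P.L ^ 2 / S.rewardThreshold ^ 2 * ∑ t ∈ range N, 1 / ((t : ℝ) + 1) ^ 3 := by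
        rw [mul_sum]
        exact sum_congr rfl fun t _ => by rw [errProb, div_mul_div_comm, mul_one]
    _ ≤ 64 * P.L ^ 2 / S.rewardThreshold ^ 2 * 2 :=
        mul_le_mul_of_nonneg_left h2 (by positivity)
    _ = 128 * P.L ^ 2 / S.rewardThreshold ^ 2 := by ring

theorem sum_Ico_errProb_nonneg (t N : ℕ) : 0 ≤ ∑ i ∈ Ico t N, S.errProb i :=
  sum_nonneg fun i _ => S.errProb_nonneg i

theorem sum_Ico_errProb_anti {t w : ℕ} (h : t ≤ w) (N : ℕ) :
    ∑ i ∈ Ico w N, S.errProb i ≤ ∑ i ∈ Ico t N, S.errProb i :=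
  sum_le_sum_of_subset_of_nonneg (Ico_subset_Ico_left h) fun i _ _ => S.errProb_nonneg i

namespace IsValid

variable {S} [∀ t, MetricSpace (E t)] {v f : ℝ} (h : S.IsValid v f)
include h

theorem rewardThreshold_pos : 0 < S.rewardThreshold := by
  have := h.η_pos; have := h.ε_pos; have := h.batchGoal_pos
  unfold rewardThreshold
  positivity

theorem three_c_le : 3 * (S.c * P.L) ≤ S.α * S.c * P.L := by
  have := mul_le_mul_of_nonneg_right h.α_ge (mul_pos h.c_pos h.L_pos).le
  linarith

theorem L_le : P.L ≤ S.c * P.L := le_mul_of_one_le_left h.L_pos.le h.c_ge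

/-- From α c ≥ 3 the threshold is at least 48 (η/ε) L, and 128/48² = 1/18. -/
theorem sum_errProb_le (N : ℕ) :
    ∑ t ∈ range N, S.errProb t ≤ 1 / 18 * (S.ε / S.η) ^ 2 := by
  refine (S.sum_errProb_le N).trans ?_
  have hη := h.η_pos
  have hε := h.ε_pos
  have hL := h.L_pos
  have h1 : 48 * (S.η / S.ε) * P.L ≤ S.rewardThreshold := by
    unfold rewardThreshold
    have h2 : 3 * P.L ≤ S.α * S.c * P.L := by linarith [h.three_c_le, h.L_le]
    have h3 : 0 ≤ 16 * S.η / S.ε := by positivity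
    calc 48 * (S.η / S.ε) * P.L = 16 * S.η / S.ε * (3 * P.L) := by ring
      _ ≤ _ := mul_le_mul_of_nonneg_left h2 h3
  calc 128 * P.L ^ 2 / S.rewardThreshold ^ 2
      ≤ 128 * P.L ^ 2 / (48 * (S.η / S.ε) * P.L) ^ 2 := by gcongr
    _ ≤ 1 / 18 * (S.ε / S.η) ^ 2 := by
      have : 128 * P.L ^ 2 / (48 * (S.η / S.ε) * P.L) ^ 2 = 1 / 18 * (S.ε / S.η) ^ 2 := by
        field_simp
        norm_num
      exact this.le

/-- One c L comes from the oracle's additive loss, the other from replacing `opt` by `maxVal`;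
neither arises for the policy started at period `0`. -/
theorem le_sum_policyReward [∀ t, Nonempty (A t)] {e : ∀ i, E i} (he : P.IsFinite e) (τ j : ℕ)
    (a : ∀ i, A i) :
    S.η * P.maxVal τ ((τ + j : ℕ)) e
      ≤ ∑ i ∈ range j, S.policyReward e τ a i + if τ = 0 then 0 else 2 * (S.c * P.L) := by
  have hcL := mul_pos h.c_pos h.L_pos
  have hV : P.policyVal (S.online τ) τ ((τ + j : ℕ)) e a
      = ∑ i ∈ range j, S.policyReward e τ a i := P.policyVal_coe _ _ _ _ _
  rcases Nat.eq_zero_or_pos j with rfl | hj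
  · rw [P.maxVal_eq_zero (by omega)]
    simp only [range_zero, sum_empty, zero_add, mul_zero]
    split_ifs <;> linarith
  rw [← hV]
  split_ifs with hτ
  · subst hτ
    have h1 := h.online.1 ((0 + j : ℕ)) (by exact_mod_cast (by omega : 0 < 0 + j)) e a he
    rw [P.opt_zero] at h1
    linarith
  · have h1 := h.online.2 τ ((τ + j : ℕ)) (by omega) (by exact_mod_cast (by omega : τ < τ + j)) e a he
    have h2 := mul_le_mul_of_nonneg_left (h.influence.maxVal_le he τ (τ + j) a) h.η_pos.le
    have h3 := mul_le_mul_of_nonneg_right h.f_le h.L_pos.le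
    have h4 := mul_le_mul_of_nonneg_left h3 h.η_pos.le
    have h5 := mul_le_of_le_one_left hcL.le h.η_le
    linarith

section Conservative

variable (e : ∀ i, E i) {N τ : ℕ} (hτ : τ ≤ N) (φ : ℝ) (p a : ∀ i, A i) (Y : ℕ → ℝ)
  (hY : ∀ t, τ ≤ t → t < N → ∀ p a,
    Y t ≤ S.valueToGo e (N - (t + 1)) (t + 1) (.predictive (t + 1 : ℕ), 0, p, a))
include hτ hY

/-- Backward induction over the periods of a conservative state. -/
theorem conservative_induction (F : ℕ → ℝ)
    (hend : F (N - τ) ≤ ∑ i ∈ range (N - τ), S.policyReward e τ a i)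
    (hstep : ∀ j, τ + j < N → F j ≤
      (1 - S.stopProb e τ (τ + j) a) * F (j + 1) + S.stopProb e τ (τ + j) a
        * (∑ i ∈ range (j + 1), S.policyReward e τ a i + Y (τ + j))) :
    F 0 ≤ S.valueToGo e (N - τ) τ (.conservative τ, φ, p, a) := by
  -- The expected reward to go, given that the first `j` tests of the phase have not triggered. As
  -- the tests ignore the executed actions, this conditioning leaves the trajectory law unchanged.
  let I : ℕ → ℝ := fun j => ∫ x, S.valueToGo e (N - τ - j) (τ + j) (.conservative τ, φ, p, x)
    ∂((S.online τ).law e τ a j)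
  have key : ∀ k j, j + k = N - τ → F j ≤ I j + ∑ i ∈ range j, S.policyReward e τ a i := by
    intro k
    induction k with
    | zero =>
      intro j hj
      have hj' : j = N - τ := by omega
      subst hj'
      have : I (N - τ) = 0 := by simp [I, valueToGo]
      linarith
    | succ k ih =>
      intro j hj
      have h1 := S.le_integral_valueToGo_conservative h.fallback e k τ j φ p a (Y := Y (τ + j))
        (fun a' => by
          have := hY (τ + j) (by omega) (by omega) p a'
          rwa [show N - (τ + j + 1) = k by omega] at this)
      have h2 : I (j + 1) = ∫ y, S.valueToGo e k (τ + j + 1) (.conservative τ, φ, p, y)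
          ∂((S.online τ).law e τ a (j + 1)) := by
        simp only [I]
        rw [show N - τ - (j + 1) = k by omega]
        rfl
      have h3 : I j = ∫ x, S.valueToGo e (k + 1) (τ + j) (.conservative τ, φ, p, x)
          ∂((S.online τ).law e τ a j) := by
        simp only [I]
        rw [show N - τ - j = k + 1 by omega]
      rw [← h2, ← h3] at h1
      have h4 := ih (j + 1) (by omega)
      have h5 := hstep j (by omega)
      have h6 := S.stopProb_le_one e τ (τ + j) a
      have h7 := mul_le_mul_of_nonneg_left h4 (sub_nonneg.2 h6)
      rw [sum_range_succ] at h5 h7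
      linarith
  have h0 := key (N - τ) 0 (by omega)
  have hI : I 0 = S.valueToGo e (N - τ) τ (.conservative τ, φ, p, a) := by
    have hm : Measurable fun x => S.valueToGo e (N - τ) τ (.conservative τ, φ, p, x) :=
      (S.measurable_valueToGo e h.fallback (N - τ) τ).comp (by fun_prop)
    exact integral_dirac' _ _ hm.stronglyMeasurable
  rw [hI] at h0
  simpa using h0

/-- Leaving with expected reward below 15/16 of the threshold may lose Λ, but has probability at
most `errProb`; the potential reserves Λ times the remaining error probabilities for it. -/
theorem conservative_robust {C Λ : ℝ} (hΛ : 0 ≤ Λ)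
    (hgood : ∀ j, τ + j < N →
      15 / 16 * S.rewardThreshold ≤ ∑ i ∈ range (j + 1), S.policyReward e τ a i →
      C - Λ * ∑ i ∈ Ico (τ + j + 1) N, S.errProb i
        ≤ ∑ i ∈ range (j + 1), S.policyReward e τ a i + Y (τ + j))
    (hbad : ∀ j, τ + j < N → C - Λ ≤ ∑ i ∈ range (j + 1), S.policyReward e τ a i + Y (τ + j))
    (hend : C ≤ ∑ i ∈ range (N - τ), S.policyReward e τ a i) :
    C - Λ * ∑ i ∈ Ico τ N, S.errProb i
      ≤ S.valueToGo e (N - τ) τ (.conservative τ, φ, p, a) := by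
  refine h.conservative_induction e hτ φ p a Y hY
    (fun j => C - Λ * ∑ i ∈ Ico (τ + j) N, S.errProb i) ?_ ?_
  · have := mul_nonneg hΛ (S.sum_Ico_errProb_nonneg (τ + (N - τ)) N)
    linarith
  · intro j hj
    have hq0 := S.stopProb_nonneg e τ (τ + j) a
    have hq1 := S.stopProb_le_one e τ (τ + j) a
    have hp0 := S.errProb_nonneg (τ + j)
    have hs : ∑ i ∈ Ico (τ + j) N, S.errProb i
        = S.errProb (τ + j) + ∑ i ∈ Ico (τ + j + 1) N, S.errProb i :=
      sum_eq_sum_Ico_succ_bot hj _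
    have ht := mul_nonneg hΛ (S.sum_Ico_errProb_nonneg (τ + j + 1) N)
    rw [hs, show τ + (j + 1) = τ + j + 1 by ring]
    have hΛp := mul_nonneg hΛ hp0
    rcases le_total (15 / 16 * S.rewardThreshold) (∑ i ∈ range (j + 1), S.policyReward e τ a i)
      with hV | hV
    · have h1 := mul_le_mul_of_nonneg_left (hgood j hj hV) hq0
      linarith
    · have hq := S.stopProb_le h.H_pos h.rewardThreshold_pos h.L_pos.le e τ j a hV
      have h1 := mul_le_mul_of_nonneg_left (hbad j hj) hq0
      have h2 := mul_le_mul_of_nonneg_right hq hΛ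
      have h3 := mul_nonneg hq0 ht
      linarith

/-- Staying costs ω per unit of expected reward V. Above 17/16 of the threshold the test fails to
trigger with probability at most `errProb`, and each such failure costs at most another ω L. The
maximum in the potential makes the lower range free; its extra `P.L` absorbs the period in which
that level is crossed. -/
theorem conservative_consistent {C ω : ℝ} (hω : 0 ≤ ω)
    (hleave : ∀ j, τ + j < N →
      C - ω * (∑ i ∈ range (j + 1), S.policyReward e τ a i)
        - ω * P.L * ∑ i ∈ Ico (τ + j + 1) N, S.errProb i
        ≤ ∑ i ∈ range (j + 1), S.policyReward e τ a i + Y (τ + j))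
    (hend : C - ω * (∑ i ∈ range (N - τ), S.policyReward e τ a i)
      ≤ ∑ i ∈ range (N - τ), S.policyReward e τ a i) :
    C - ω * (17 / 16 * S.rewardThreshold + P.L) - ω * P.L * ∑ i ∈ Ico τ N, S.errProb i
      ≤ S.valueToGo e (N - τ) τ (.conservative τ, φ, p, a) := by
  have hL := h.L_pos
  have hT := h.rewardThreshold_pos
  have hωL := mul_nonneg hω hL.le
  have key := h.conservative_induction e hτ φ p a Y hY
    (fun j => C - ω * (max (∑ i ∈ range j, S.policyReward e τ a i) (17 / 16 * S.rewardThreshold)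
      + P.L) - ω * P.L * ∑ i ∈ Ico (τ + j) N, S.errProb i) ?_ ?_
  · rwa [range_zero, sum_empty, max_eq_right (by positivity), add_zero] at key
  · have h1 := mul_nonneg hωL (S.sum_Ico_errProb_nonneg (τ + (N - τ)) N)
    have h2 := mul_le_mul_of_nonneg_left (le_max_left
      (∑ i ∈ range (N - τ), S.policyReward e τ a i) (17 / 16 * S.rewardThreshold)) hω
    linarith
  · intro j hj
    have hq0 := S.stopProb_nonneg e τ (τ + j) a
    have hq1 := S.stopProb_le_one e τ (τ + j) a
    have hp0 := S.errProb_nonneg (τ + j)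
    have hs : ∑ i ∈ Ico (τ + j) N, S.errProb i
        = S.errProb (τ + j) + ∑ i ∈ Ico (τ + j + 1) N, S.errProb i :=
      sum_eq_sum_Ico_succ_bot hj _
    have hleave := hleave j hj
    rw [hs, show τ + (j + 1) = τ + j + 1 by ring]
    have hVs := sum_range_succ (S.policyReward e τ a) j
    have hv := S.policyReward_le e τ a j
    have hone := fun hV => S.one_sub_stopProb_le h.H_pos h.rewardThreshold_pos h.L_pos.le e τ j a hV
    set V' := ∑ i ∈ range (j + 1), S.policyReward e τ a i
    set V := ∑ i ∈ range j, S.policyReward e τ a i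
    set R := ∑ i ∈ Ico (τ + j + 1) N, S.errProb i
    set q := S.stopProb e τ (τ + j) a
    have hm1 : ω * (17 / 16 * S.rewardThreshold) ≤ ω * max V (17 / 16 * S.rewardThreshold) :=
      mul_le_mul_of_nonneg_left (le_max_right _ _) hω
    have hm2 : ω * V ≤ ω * max V (17 / 16 * S.rewardThreshold) :=
      mul_le_mul_of_nonneg_left (le_max_left _ _) hω
    have hωp := mul_nonneg hωL hp0
    set m := max V (17 / 16 * S.rewardThreshold)
    have hωV : ω * V' ≤ ω * V + ω * P.L := by
      rw [← mul_add]; exact mul_le_mul_of_nonneg_left (by linarith) hω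
    rcases le_total V' (17 / 16 * S.rewardThreshold) with hV | hV
    · rw [max_eq_right hV]
      have h1 : C - ω * (m + P.L) - ω * P.L * R ≤ V' + Y (τ + j) := by
        have := mul_le_mul_of_nonneg_left hV hω
        linarith
      have h2 : C - ω * (m + P.L) - ω * P.L * R
          ≤ C - ω * (17 / 16 * S.rewardThreshold + P.L) - ω * P.L * R := by linarith
      have h3 := mul_le_mul_of_nonneg_left h1 hq0
      have h4 := mul_le_mul_of_nonneg_left h2 (sub_nonneg.2 hq1)
      linarith
    · rw [max_eq_left hV]
      have hq := mul_le_mul_of_nonneg_right (hone hV) hωL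
      have h1 : C - ω * (m + P.L) - ω * P.L * R ≤ V' + Y (τ + j) := by linarith
      have h2 : C - ω * (m + P.L) - ω * P.L * R - ω * P.L
          ≤ C - ω * (V' + P.L) - ω * P.L * R := by linarith
      have h3 := mul_le_mul_of_nonneg_left h1 hq0
      have h4 := mul_le_mul_of_nonneg_left h2 (sub_nonneg.2 hq1)
      linarith

end Conservative

variable [∀ t, Nonempty (A t)]

/-- The later conservative phases covered by the induction feed `predictive_bound`, whose result is
the continuation after the present phase. -/
theorem robust_bound {e : ∀ i, E i} (he : P.IsFinite e) {N : ℕ} (τ : ℕ) (hτ : τ ≤ N) (φ : ℝ)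
    (p a : ∀ i, A i) :
    (S.η - 15 / 16 * S.ε) * P.maxVal τ N e - (if τ = 0 then 0 else 2 * (S.c * P.L))
      - (S.η - 15 / 16 * S.ε) * P.maxVal 0 N e * ∑ i ∈ Ico τ N, S.errProb i
      ≤ S.valueToGo e (N - τ) τ (.conservative τ, φ, p, a) := by
  have hL := h.L_pos
  have hα := h.α_pos
  have hb := h.b_pos
  have hc := h.c_pos
  have hη := h.η_pos
  have hε := h.ε_pos
  have hr := h.batchRatio_pos
  have hr1 := h.batchRatio_le_one
  have hD := h.batchGoal_pos
  have hcL := mul_pos hc hL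
  have h3c := h.three_c_le
  have hΘ := h.errorThreshold_pos
  have hκ := h.ρ_pos
  have hκr : S.η - 15 / 16 * S.ε ≤ S.batchRatio := by have := h.ratio; linarith
  have hΘeq := S.errorThreshold_eq
  have hκη : (S.η - 15 / 16 * S.ε) / S.η = 1 - 15 / 16 * (S.ε / S.η) := by field_simp
  set κ := S.η - 15 / 16 * S.ε with hκdef
  set r := S.batchRatio
  set Λ := κ * P.maxVal 0 N e
  set β := κ * (1 + 1 / r) * (S.b * P.L) with hβdef
  have hΛ : 0 ≤ Λ := mul_nonneg hκ.le (P.maxVal_nonneg _ _ _)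
  have hβ : 0 ≤ β := by positivity
  have hκη1 : κ / S.η ≤ 1 := by
    rw [hκη]
    have : 0 ≤ S.ε / S.η := by positivity
    linarith
  have hκη0 : 0 ≤ κ / S.η := by positivity
  -- The normalising factor of `errorThreshold` cancels κ/r, leaving 5 (1 + r) ≤ 10.
  have hβΘ : β * S.errorThreshold ≤ 10 * (S.α * S.c * P.L) := by
    have : β * S.errorThreshold = 5 * (1 + r) * (S.α * S.c * P.L) := by
      rw [hΘeq, hβdef]
      field_simp
      ring
    rw [this]
    exact mul_le_mul_of_nonneg_right (by linarith) hD.le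
  have hβc : β * (S.c / S.b) ≤ 2 * (S.c * P.L) := by
    have h1 : β * (S.c / S.b) = (κ + κ / r) * (S.c * P.L) := by
      rw [hβdef]
      field_simp
    have h2 : κ / r ≤ 1 := by rwa [div_le_one hr]
    rw [h1]
    exact mul_le_mul_of_nonneg_right (by linarith) hcL.le
  induction hk : N - τ using Nat.strong_induction_on generalizing τ φ p a with
  | _ k ih =>
    subst hk
    let tail : ℕ → ℝ := fun t => Λ * ∑ i ∈ Ico t N, S.errProb i
    have htail : ∀ t, 0 ≤ tail t := fun t => mul_nonneg hΛ (S.sum_Ico_errProb_nonneg t N)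
    have htail_anti : ∀ t w, t ≤ w → tail w ≤ tail t := fun t w htw =>
      mul_le_mul_of_nonneg_left (S.sum_Ico_errProb_anti htw N) hΛ
    let g : ℕ → ℝ → ℝ := fun t φ =>
      -- The error that the phase can still accumulate, the start-up loss of the next conservative
      -- phase, and the reserve for wrong tests.
      β * (S.errorThreshold + S.c / S.b - φ) + 2 * (S.c * P.L) + tail t
    have hpred := h.predictive_bound he (N := N) hκ.le hκr (fun w => 2 * (S.c * P.L) + tail w) g τ
      (fun w hw hτw φ p a => by
        have := ih (N - w) (by omega) w hw φ p a rfl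
        rw [if_neg (by omega)] at this
        simp only [tail]
        linarith)
      (fun t w φ htw _ _ => by
        have := htail_anti t w htw.le
        simp only [g]
        linarith)
      (fun t w φ htw _ _ hlt => by
        have := htail_anti t w htw.le
        have h1 := mul_le_mul_of_nonneg_left hlt.le hβ
        simp only [g]
        linarith)
      (fun t φ _ _ hlt => by
        have := htail t
        have h1 := mul_le_mul_of_nonneg_left hlt.le hβ
        simp only [g]
        linarith)
    let Y : ℕ → ℝ := fun t =>
      -- Truncation at zero bounds the damage of a premature switch by `Λ`.
      max 0 (κ * P.maxVal ((t + 1 : ℕ)) N e - (S.α * S.c * P.L + S.c * P.L) - g (t + 1) 0)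
    have hχ : κ / S.η * (if τ = 0 then 0 else 2 * (S.c * P.L))
        ≤ if τ = 0 then 0 else 2 * (S.c * P.L) :=
      mul_le_of_le_one_left (by split_ifs <;> linarith) hκη1
    have hχ0 : 0 ≤ if τ = 0 then 0 else 2 * (S.c * P.L) := by split_ifs <;> linarith
    have hUV : ∀ j, κ * P.maxVal τ ((τ + j : ℕ)) e
        ≤ κ / S.η * (∑ i ∈ range j, S.policyReward e τ a i)
          + if τ = 0 then 0 else 2 * (S.c * P.L) := by
      intro j
      have h1 := mul_le_mul_of_nonneg_left (h.le_sum_policyReward he τ j a) hκη0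
      rw [mul_add, ← mul_assoc, div_mul_cancel₀ _ hη.ne'] at h1
      linarith
    have hV0 : ∀ j, 0 ≤ ∑ i ∈ range j, S.policyReward e τ a i := fun j =>
      sum_nonneg fun i _ => S.policyReward_nonneg e τ a i
    refine h.conservative_robust e hτ φ p a Y ?_ hΛ ?_ ?_ ?_
    · intro t htτ htN p a
      exact max_le (S.valueToGo_nonneg e _ _ _)
        (hpred (t + 1) (by omega) htN 0 le_rfl hΘ p a)
    · intro j hj hV
      have h1 := hUV (j + 1)
      have h2 := mul_le_mul_of_nonneg_left
        (P.maxVal_add_le (m := τ) (k := τ + (j + 1)) (n := N) (by omega) (by omega) e) hκ.le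
      have h3 : κ * P.maxVal ((τ + j + 1 : ℕ)) N e - (S.α * S.c * P.L + S.c * P.L)
        - g (τ + j + 1) 0 ≤ Y (τ + j) := le_max_right _ _
      -- The right side is the surplus (1 - κ/η) V. The predictive phase needs at most 11 α c L + 5
      -- c L ≤ (38/3) α c L, which is less than 225/16 α c L.
      have h4 : 225 / 16 * (S.α * S.c * P.L) ≤ 15 / 16 * (S.ε / S.η)
          * ∑ i ∈ range (j + 1), S.policyReward e τ a i := by
        have h5 : 15 / 16 * (S.ε / S.η) * (15 / 16 * S.rewardThreshold)
            = 225 / 16 * (S.α * S.c * P.L) := by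
          unfold rewardThreshold
          field_simp
          norm_num
        rw [← h5]
        exact mul_le_mul_of_nonneg_left hV (by positivity)
      rw [hκη] at h1
      simp only [g, tail, sub_zero] at h3
      rw [mul_add] at h2 h3
      rw [show τ + (j + 1) = τ + j + 1 by ring] at h1 h2
      linarith
    · intro j hj
      have h1 : 0 ≤ Y (τ + j) := le_max_left _ _
      have h2 := mul_le_mul_of_nonneg_left (P.maxVal_anti_left (n := N) (Nat.zero_le τ) e) hκ.le
      have h3 := hV0 (j + 1)
      linarith
    · have h1 := hUV (N - τ)
      rw [Nat.add_sub_cancel' hτ] at h1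
      have h2 := mul_le_of_le_one_left (hV0 (N - τ)) hκη1
      linarith

end IsValid

end AdaSwitch

end OnlineDecision

/-! ### The consistent bound. -/

namespace OnlineDecision

open Finset

variable {E : ℕ → Type uE} {A : ℕ → Type uA} [∀ t, MeasurableSpace (A t)]

namespace AdaSwitch

variable {P : Problem E A} (S : AdaSwitch P)

/-- The guaranteed competitive ratio if the prediction is correct, up to an additive loss. -/
noncomputable def consistency : ℝ := S.γ - S.γ ^ 2 / S.α

/-- The loss relative to the optimum per unit of prediction error. -/
noncomputable def errCost : ℝ :=
  20 * (S.α * S.c * P.L) / S.ε / S.errorThreshold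
    + S.consistency * (1 + 1 / S.batchRatio) * (S.b * P.L)

namespace IsValid

variable {S} [∀ t, MetricSpace (E t)] {v f : ℝ} (h : S.IsValid v f)
include h

theorem consistency_nonneg : 0 ≤ S.consistency := by
  have h1 := h.γ_pos; have h2 := h.α_pos; have h3 := h.γ_le; have h4 := h.α_ge
  rw [consistency, sub_nonneg, div_le_iff₀ h2]
  nlinarith

theorem consistency_le_γ : S.consistency ≤ S.γ := by
  have h2 := h.α_pos
  have : 0 ≤ S.γ ^ 2 / S.α := by positivity
  unfold consistency
  linarith

theorem consistency_le_batchRatio : S.consistency ≤ S.batchRatio := by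
  have h1 := h.γ_pos; have h2 := h.α_pos
  rw [consistency, batchRatio, le_div_iff₀ (by positivity)]
  have : (S.γ - S.γ ^ 2 / S.α) * (S.α + S.γ) = S.γ * S.α - S.γ ^ 3 / S.α := by
    field_simp
    ring
  have h3 : 0 ≤ S.γ ^ 3 / S.α := by positivity
  linarith

theorem errCost_nonneg : 0 ≤ S.errCost := by
  have := h.ε_pos; have := h.batchGoal_pos; have := h.batchRatio_pos; have := h.b_pos
  have := h.L_pos; have := h.errorThreshold_pos; have := h.consistency_nonneg
  unfold errCost
  positivity

/-- With 1/r ≤ 4/(3γ) from α ≥ 3, the switching part is at most (16/3)(η - 15ε/16), and the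
Lipschitz part at most 2ε, both in units of b L/(εγ); their sum 16η/3 - 3ε is below 7η. -/
theorem errCost_le : S.errCost ≤ P.L / S.ε * (7 * S.b * S.η / S.γ) := by
  have hε := h.ε_pos
  have hη := h.η_pos
  have hγ := h.γ_pos
  have hα := h.α_pos
  have hb := h.b_pos
  have hc := h.c_pos
  have hL := h.L_pos
  have hr := h.batchRatio_pos
  have hρ := h.ρ_pos
  have hbL := mul_pos hb hL
  have h1 : 20 * (S.α * S.c * P.L) / S.ε / S.errorThreshold
      = 4 * (S.b * P.L) / S.ε * ((S.η - 15 / 16 * S.ε) * (1 / S.batchRatio)) := by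
    rw [S.errorThreshold_eq]
    field_simp
    ring
  have h2 : 1 / S.batchRatio ≤ 4 / 3 * (1 / S.γ) := by
    have : 1 / S.batchRatio = (S.α + S.γ) / S.α * (1 / S.γ) := by
      unfold batchRatio; field_simp
    rw [this]
    refine mul_le_mul_of_nonneg_right ?_ (by positivity)
    rw [div_le_iff₀ hα]
    linarith [h.α_ge, h.γ_le]
  have h3 : S.consistency * (1 + 1 / S.batchRatio) ≤ 2 := by
    have h4 : S.consistency / S.batchRatio ≤ 1 := by
      rw [div_le_one hr]; exact h.consistency_le_batchRatio
    have h5 := h.consistency_le_γ.trans h.γ_le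
    rw [mul_add, mul_one_div]
    linarith
  have h6 : 2 ≤ 2 / S.ε * S.ε * (1 / S.γ) := by
    rw [div_mul_cancel₀ _ hε.ne', mul_one_div, le_div_iff₀ hγ]
    linarith [h.γ_le]
  unfold errCost
  rw [h1]
  calc 4 * (S.b * P.L) / S.ε * ((S.η - 15 / 16 * S.ε) * (1 / S.batchRatio))
        + S.consistency * (1 + 1 / S.batchRatio) * (S.b * P.L)
      ≤ 4 * (S.b * P.L) / S.ε * ((S.η - 15 / 16 * S.ε) * (4 / 3 * (1 / S.γ)))
        + 2 / S.ε * S.ε * (1 / S.γ) * (S.b * P.L) := by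
        refine add_le_add ?_ (mul_le_mul_of_nonneg_right (h3.trans h6) hbL.le)
        gcongr
    _ = P.L / S.ε * (S.b * (16 / 3 * S.η - 3 * S.ε) / S.γ) := by
        field_simp
        ring
    _ ≤ P.L / S.ε * (7 * S.b * S.η / S.γ) := by
        gcongr P.L / S.ε * (?_ / S.γ)
        have : S.b * (16 / 3 * S.η - 3 * S.ε) ≤ S.b * (7 * S.η) :=
          mul_le_mul_of_nonneg_left (by linarith) hb.le
        linarith

variable [∀ t, Nonempty (A t)]

/-- The additive loss covers one conservative phase and one unfinished batch. Any later conservative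
phase is financed by the error that triggered it, through the first summand of `errCost`. -/
theorem consistent_bound {e : ∀ i, E i} (he : P.IsFinite e) {N : ℕ} (τ : ℕ) (hτ : τ ≤ N) (φ : ℝ)
    (p a : ∀ i, A i) :
    S.consistency * P.maxVal τ N e
      - ((if τ = 0 then 17 + 1 / 3 else 18) * ((S.α * S.c * P.L) / S.ε))
      - S.errCost * ∑ i ∈ Ico τ N, S.err e i
      - max (S.consistency / S.η - 1) 0 * P.L * ∑ i ∈ Ico τ N, S.errProb i
      ≤ S.valueToGo e (N - τ) τ (.conservative τ, φ, p, a) := by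
  have hL := h.L_pos
  have hα := h.α_pos
  have hb := h.b_pos
  have hc := h.c_pos
  have hη := h.η_pos
  have hε := h.ε_pos
  have hr := h.batchRatio_pos
  have hD := h.batchGoal_pos
  have hcL := mul_pos hc hL
  have h3c := h.three_c_le
  have hΘ := h.errorThreshold_pos
  have hκ := h.consistency_nonneg
  have hκr := h.consistency_le_batchRatio
  have hκ1 : S.consistency ≤ 1 := h.consistency_le_γ.trans h.γ_le
  have hW := h.errCost_nonneg
  have hε1 : S.ε ≤ 1 := h.ε_lt.le.trans h.η_le
  have hWdef : S.errCost = 20 * (S.α * S.c * P.L) / S.ε / S.errorThreshold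
    + S.consistency * (1 + 1 / S.batchRatio) * (S.b * P.L) := rfl
  set κ := S.consistency
  set D := S.α * S.c * P.L
  set ω := max (κ / S.η - 1) 0
  -- The charge for a return to the conservative state. Its loss is at most 18 D/ε; 20 leaves slack
  -- and cancels against the 5 in `errorThreshold`.
  set Q := 20 * D / S.ε with hQ
  set β := κ * (1 + 1 / S.batchRatio) * (S.b * P.L) with hβdef
  have hβ : 0 ≤ β := by positivity
  have hQ0 : 0 ≤ Q := by positivity
  have hQΘ : 0 ≤ Q / S.errorThreshold := by positivity
  have hω : 0 ≤ ω := le_max_right _ _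
  have hωL : 0 ≤ ω * P.L := mul_nonneg hω hL.le
  have hκω : κ / S.η ≤ 1 + ω := by linarith [le_max_left (κ / S.η - 1) 0]
  have hκη0 : 0 ≤ κ / S.η := by positivity
  have hDε : D ≤ D / S.ε := by rw [le_div_iff₀ hε]; exact mul_le_of_le_one_right hD.le hε1
  have hωη : ω * S.η ≤ 1 - S.ε := by
    rw [max_mul_of_nonneg _ _ hη.le, sub_mul, div_mul_cancel₀ _ hη.ne', zero_mul]
    exact max_le (by linarith [h.ε_lt]) (by linarith)
  have hωε : ω ≤ 1 / S.ε := by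
    have : ω * S.ε ≤ 1 := by
      have := mul_le_mul_of_nonneg_left h.ε_lt.le hω
      linarith
    rwa [le_div_iff₀ hε]
  have hκε : κ / S.η ≤ 1 / S.ε := div_le_div₀ zero_le_one hκ1 hε h.ε_lt.le
  have hcD : S.c * P.L / S.ε ≤ 1 / 3 * (D / S.ε) := by
    rw [← mul_div_assoc]
    exact div_le_div_of_nonneg_right (by linarith) hε.le
  -- From ω η ≤ 1 - ε the main term is at most 17 D/ε - 17 D; the spare 17 D covers the unfinished
  -- batch, and ω L costs the remaining third.
  have hloss : ω * (17 / 16 * S.rewardThreshold + P.L) + (D + S.c * P.L)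
      ≤ (17 + 1 / 3) * (D / S.ε) := by
    have h1 : ω * (17 / 16 * S.rewardThreshold) = 17 * (ω * S.η) * (D / S.ε) := by
      unfold rewardThreshold
      ring
    have h2 : 17 * (ω * S.η) * (D / S.ε) ≤ 17 * (1 - S.ε) * (D / S.ε) := by gcongr
    have h3 : 17 * (1 - S.ε) * (D / S.ε) = 17 * (D / S.ε) - 17 * D := by field_simp
    have h4 : ω * P.L ≤ 1 / 3 * (D / S.ε) := by
      calc ω * P.L ≤ 1 / S.ε * (S.c * P.L) :=
            mul_le_mul hωε h.L_le hL.le (by positivity)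
        _ = S.c * P.L / S.ε := by ring
        _ ≤ _ := hcD
    rw [mul_add]
    linarith
  induction hk : N - τ using Nat.strong_induction_on generalizing τ φ p a with
  | _ k ih =>
    subst hk
    let tail : ℕ → ℝ := fun t => ω * P.L * ∑ i ∈ Ico t N, S.errProb i
    have htail : ∀ t, 0 ≤ tail t := fun t => mul_nonneg hωL (S.sum_Ico_errProb_nonneg t N)
    have htail_anti : ∀ t w, t ≤ w → tail w ≤ tail t := fun t w htw =>
      mul_le_mul_of_nonneg_left (S.sum_Ico_errProb_anti htw N) hωL
    let F : ℕ → ℝ := fun t => ∑ i ∈ Ico t N, S.err e i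
    have hF0 : ∀ t, 0 ≤ F t := fun t => h.sum_err_nonneg e _
    have hF : ∀ t w, t ≤ w → w ≤ N → F t = ∑ i ∈ Ico t w, S.err e i + F w := fun t w h1 h2 =>
      (sum_Ico_consecutive _ h1 h2).symm
    -- All future error is charged for its effect on batches; together with the `φ` already
    -- accumulated it also saves up the charge `Q` due at the threshold.
    let g : ℕ → ℝ → ℝ := fun t φ => β * F t + Q / S.errorThreshold * (F t + φ) + tail t
    have hpred := h.predictive_bound he (N := N) hκ hκr
      (fun w => Q + S.errCost * F w + tail w) g τ
      (fun w hw hτw φ p a => by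
        have := ih (N - w) (by omega) w hw φ p a rfl
        rw [if_neg (by omega)] at this
        have hQ' : Q = 20 * (D / S.ε) := by rw [hQ]; ring
        simp only [tail, F]
        linarith)
      (fun t w φ htw hwN _ => by
        have h1 := htail_anti t w htw.le
        simp only [g]
        rw [hF t w htw.le hwN]
        linarith)
      (fun t w φ htw hwN hge _ => by
        have h1 := htail_anti t w htw.le
        have h2 := mul_le_mul_of_nonneg_left hge hQΘ
        rw [div_mul_cancel₀ _ hΘ.ne'] at h2
        simp only [g]
        rw [hF t w htw.le hwN, hWdef]
        linarith)
      (fun t φ _ hφ0 _ => by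
        have h1 := htail t
        have h2 := mul_nonneg hQΘ (add_nonneg (hF0 t) hφ0)
        simp only [g, F] at h2 ⊢
        linarith)
    let Y : ℕ → ℝ := fun t =>
      κ * P.maxVal ((t + 1 : ℕ)) N e - (D + S.c * P.L) - g (t + 1) 0
    have hUV : ∀ j, κ * P.maxVal τ ((τ + j : ℕ)) e
        ≤ (1 + ω) * (∑ i ∈ range j, S.policyReward e τ a i)
          + κ / S.η * (if τ = 0 then 0 else 2 * (S.c * P.L)) := by
      intro j
      have h1 := mul_le_mul_of_nonneg_left (h.le_sum_policyReward he τ j a) hκη0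
      have h2 := mul_le_mul_of_nonneg_right hκω
        (sum_nonneg fun i (_ : i ∈ range j) => S.policyReward_nonneg e τ a i)
      rw [mul_add, ← mul_assoc, div_mul_cancel₀ _ hη.ne'] at h1
      linarith
    -- A start after period `0` loses 2 c L more, at most (2/3) D/ε after scaling: this is the step
    -- from 17 + 1/3 to 18.
    have hχ : κ / S.η * (if τ = 0 then 0 else 2 * (S.c * P.L))
        + (17 + 1 / 3) * (D / S.ε)
        ≤ (if τ = 0 then 17 + 1 / 3 else 18) * (D / S.ε) := by
      split_ifs
      · rw [mul_zero, zero_add]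
      · have h1 := mul_le_mul_of_nonneg_right hκε hcL.le
        rw [one_div_mul_eq_div] at h1
        linarith
    have hmain := h.conservative_consistent e hτ φ p a Y
      (fun t htτ htN p a => hpred (t + 1) (by omega) htN 0 le_rfl hΘ p a)
      (C := κ * P.maxVal τ N e - κ / S.η * (if τ = 0 then 0 else 2 * (S.c * P.L))
        - (D + S.c * P.L) - S.errCost * F τ) hω ?_ ?_
    · linarith
    · intro j hj
      have h1 := hUV (j + 1)
      have h2 := mul_le_mul_of_nonneg_left
        (P.maxVal_add_le (m := τ) (k := τ + (j + 1)) (n := N) (by omega) (by omega) e) hκ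
      have h3 : S.errCost * F (τ + j + 1) ≤ S.errCost * F τ := by
        refine mul_le_mul_of_nonneg_left ?_ hW
        rw [hF τ (τ + j + 1) (by omega) (by omega)]
        linarith [h.sum_err_nonneg e (Ico τ (τ + j + 1))]
      rw [hWdef] at h3 ⊢
      simp only [Y, g, tail, add_zero]
      rw [mul_add] at h2
      rw [show τ + (j + 1) = τ + j + 1 by ring] at h1 h2
      linarith
    · have h1 := hUV (N - τ)
      rw [Nat.add_sub_cancel' hτ] at h1
      have h2 := mul_nonneg hW (hF0 τ)
      linarith

end IsValid

end AdaSwitch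

end OnlineDecision

/-! ### Assembling the two bounds. -/

theorem mainTheorem2 :
    -- the constant of `H = Ω(η α c L³ / ε²)`
    ∃ C : ℝ, 0 < C ∧
    ∀ (E : ℕ → Type uE) (A : ℕ → Type uA) [∀ t, MetricSpace (E t)] [∀ t, MeasurableSpace (A t)]
      [∀ t, Nonempty (A t)] (P : OnlineDecision.Problem E A) (u v f : ℝ),
      P.StronglyLipschitz u v → P.BoundedInfluence f →
    ∀ (γ η : ℝ) (offline : OnlineDecision.OfflineAlgorithm E A)
      (online : ℕ → OnlineDecision.Policy E A)
      (est : ℕ → (∀ i, E i) → (∀ i, E i) → ℕ) (fallback : ℕ → (∀ i, A i) → ∀ i, A i),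
      0 < γ → P.IsOfflineOracle γ offline → P.IsOnlineOracle η f online →
      P.IsEffLengthEstimator est → (∀ t, Measurable (fallback t)) →
    ∀ (e p : ∀ i, E i), P.IsFinite e → 0 < P.optTotal e → {t | e t ≠ p t}.Finite →
    ∀ (ε α b c : ℝ) (H : ℕ), 0 < ε → ε < η → b = u → c = max v f → 1 ≤ b → b ≤ c →
      3 ≤ α → η - 15 * ε / 16 ≤ γ * α / (α + γ) →
      C * (η * α * c * P.L ^ 3 / ε ^ 2) ≤ H →
    ∀ φ : ℝ, φ = ∑' t, min (dist (e t) (p t)) (c / b) →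
      max (η - ε)
          (γ - γ ^ 2 / α - P.L / (ε * P.optTotal e) * (18 * α * c + 7 * b * η * φ / γ))
        ≤ OnlineDecision.AdaSwitch.comp
            ({ offline := offline, online := online, est := est, fallback := fallback,
               prediction := p, η := η, γ := γ, ε := ε, α := α, b := b, c := c, H := H } :
              OnlineDecision.AdaSwitch P) e
      ∧ φ ≤ ∑' t, dist (e t) (p t) := by
  refine ⟨1, one_pos, ?_⟩
  intro E A _ _ _ P u v f hlip hinf γ η offline online est fallback hγ hoff hon hest hfb e p he hopt
    hne ε α b c H hε hεη hbu hcvf hb hbc hα hratio hH φ hφ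
  obtain ⟨N, hN⟩ := he.exists_isHorizon
  let a₀ : ∀ i, A i := fun _ => Classical.arbitrary _
  have hO : P.optTotal e = P.maxVal 0 N e := hN.optTotal_eq
  have hO' : 0 < P.maxVal 0 N e := hO ▸ hopt
  have hN0 : 0 < N := by
    rcases Nat.eq_zero_or_pos N with rfl | h0
    · rw [P.maxVal_eq_zero le_rfl] at hO'; exact absurd hO' (lt_irrefl _)
    · exact h0
  have hL : 0 < P.L := by
    by_contra hL
    have : P.maxVal 0 N e ≤ 0 := ciSup_le fun a => (P.val_le 0 N e a).trans
      (mul_nonpos_of_nonneg_of_nonpos (Nat.cast_nonneg _) (not_lt.1 hL))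
    linarith
  have hc : 0 < c := by linarith
  have hη : 0 < η := hε.trans hεη
  -- An oracle cannot beat a positive optimum; the same reasoning gives η ≤ 1.
  have hγ1 : γ ≤ 1 := by
    have h1 := hoff 0 N (by exact_mod_cast hN0) e a₀ he
    rw [P.opt_zero] at h1
    have h2 := h1.trans (P.val_le_maxVal 0 N e _)
    by_contra hlt
    nlinarith
  have hη1 : η ≤ 1 := by
    have h1 := hon.1 N (by exact_mod_cast hN0) e a₀ he
    have h3 : P.policyVal (online 0) 0 N e a₀ ≤ P.maxVal 0 N e := by
      have h4 := P.policyVal_coe (online 0) e 0 N a₀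
      rw [← P.integral_val_law, Nat.zero_add] at h4
      rw [h4]
      refine (MeasureTheory.integral_mono (OnlineDecision.integrable_of_abs_le
        (P.measurable_val _ _ _) (P.abs_val_le _ _ _)) (MeasureTheory.integrable_const _)
        fun a => P.val_le_maxVal 0 N e a).trans_eq ?_
      simp
    rw [P.opt_zero] at h1
    have h2 := h1.trans h3
    by_contra hlt
    nlinarith
  have hH0 : 0 < H := by
    have h1 : 0 < 1 * (η * α * c * P.L ^ 3 / ε ^ 2) := by
      have : 0 < α := by linarith
      positivity
    exact_mod_cast h1.trans_le hH
  have hlip' : P.StronglyLipschitz b v := hbu ▸ hlip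
  have hvc : v ≤ c := hcvf ▸ le_max_left _ _
  have hfc : f ≤ c := hcvf ▸ le_max_right _ _
  set S : OnlineDecision.AdaSwitch P :=
    { offline := offline, online := online, est := est, fallback := fallback,
      prediction := p, η := η, γ := γ, ε := ε, α := α, b := b, c := c, H := H } with hS
  have h : S.IsValid v f :=
    { lipschitz := hlip', influence := hinf, offline := hoff, online := hon, est := hest,
      fallback := hfb, prediction := he.of_finite_ne hne, L_pos := hL, γ_pos := hγ, γ_le := hγ1,
      η_le := hη1, ε_pos := hε, ε_lt := hεη, b_ge := hb, b_le := hbc,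
      v_le := hvc, f_le := hfc, α_ge := hα,
      ratio := hratio, H_pos := hH0 }
  have hsupp : ∀ t ∉ hne.toFinset, dist (e t) (p t) = 0 := by
    intro t ht
    have : ¬ e t ≠ p t := by simpa using ht
    rw [not_not.1 this, dist_self]
  have hsum1 : Summable fun t => dist (e t) (p t) := summable_of_ne_finset_zero hsupp
  have herr : ∀ t, S.err e t = min (dist (e t) (p t)) (c / b) := fun t => rfl
  have hsum2 : Summable fun t => S.err e t :=
    Summable.of_nonneg_of_le (h.err_nonneg e) (fun t => min_le_left _ _) hsum1
  have hφ' : φ = ∑' t, S.err e t := hφ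
  refine ⟨?_, ?_⟩
  swap
  · rw [hφ']
    exact hsum2.tsum_le_tsum (fun t => min_le_left _ _) hsum1
  have hF : ∑ i ∈ Finset.Ico 0 N, S.err e i ≤ φ := by
    rw [hφ']
    exact hsum2.sum_le_tsum _ fun t _ => h.err_nonneg e t
  have hp := h.sum_errProb_le N
  rw [← Nat.Ico_zero_eq_range] at hp
  have hp0 := S.sum_Ico_errProb_nonneg 0 N
  have hεη' : ε / η ≤ 1 := by rw [div_le_one hη]; exact hεη.le
  have hεη0 : 0 < ε / η := by positivity
  rw [OnlineDecision.AdaSwitch.comp, le_div_iff₀ hopt, S.value_eq_valueToGo e hfb hN, hO,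
    max_mul_of_nonneg _ _ hO'.le]
  refine max_le ?_ ?_
  · have h1 := h.robust_bound he 0 (Nat.zero_le N) 0 a₀ a₀
    rw [if_pos rfl, Nat.sub_zero, sub_zero] at h1
    refine le_trans ?_ h1
    -- Wrong exits use up the last sixteenth of ε.
    have h2 : (η - 15 / 16 * ε) * ∑ i ∈ Finset.Ico 0 N, S.errProb i ≤ 1 / 16 * ε := by
      calc (η - 15 / 16 * ε) * ∑ i ∈ Finset.Ico 0 N, S.errProb i
          ≤ η * (1 / 18 * (ε / η) ^ 2) := by
            refine mul_le_mul (by linarith) hp hp0 hη.le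
        _ = 1 / 18 * ε * (ε / η) := by field_simp
        _ ≤ 1 / 18 * ε * 1 := by gcongr
        _ ≤ 1 / 16 * ε := by linarith
    have h3 := mul_le_mul_of_nonneg_right h2 hO'.le
    change (η - ε) * _ ≤ (η - 15 / 16 * ε) * _ - (η - 15 / 16 * ε) * _ * _
    linarith
  · have h1 := h.consistent_bound he 0 (Nat.zero_le N) 0 a₀ a₀
    rw [if_pos rfl, Nat.sub_zero] at h1
    refine le_trans ?_ h1
    have hD : 0 < α * c * P.L := h.batchGoal_pos
    have h2 : S.errCost * ∑ i ∈ Finset.Ico 0 N, S.err e i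
        ≤ P.L / ε * (7 * b * η / γ) * φ :=
      mul_le_mul h.errCost_le hF (h.sum_err_nonneg e _) (by positivity)
    -- The start at period `0` loses only 17 + 1/3 units of α c L / ε, which leaves room below 18
    -- for late exits.
    have h3 : max (S.consistency / η - 1) 0 * P.L * ∑ i ∈ Finset.Ico 0 N, S.errProb i
        ≤ 1 / 3 * (α * c * P.L / ε) := by
      have hω : max (S.consistency / η - 1) 0 ≤ 1 / η := by
        refine max_le ?_ (by positivity)
        have : S.consistency / η ≤ 1 / η :=
          div_le_div_of_nonneg_right (h.consistency_le_γ.trans h.γ_le) hη.le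
        linarith
      have hLD : P.L ≤ 1 / 3 * (α * c * P.L) := by
        have h4 : 3 * (c * P.L) ≤ α * c * P.L := h.three_c_le
        have h5 : P.L ≤ c * P.L := h.L_le
        linarith
      have hηε : 1 / η ≤ 1 / ε := one_div_le_one_div_of_le hε hεη.le
      have hp1 : ∑ i ∈ Finset.Ico 0 N, S.errProb i ≤ 1 := by
        refine hp.trans ?_
        change 1 / 18 * (ε / η) ^ 2 ≤ 1
        nlinarith
      calc max (S.consistency / η - 1) 0 * P.L * ∑ i ∈ Finset.Ico 0 N, S.errProb i
          ≤ 1 / ε * (1 / 3 * (α * c * P.L)) * 1 := by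
            refine mul_le_mul (mul_le_mul (hω.trans hηε) hLD hL.le (by positivity)) hp1 hp0
              (by positivity)
        _ = 1 / 3 * (α * c * P.L / ε) := by ring
    have h4 : (γ - γ ^ 2 / α - P.L / (ε * P.maxVal 0 N e) * (18 * α * c + 7 * b * η * φ / γ))
        * P.maxVal 0 N e = (γ - γ ^ 2 / α) * P.maxVal 0 N e - 18 * (α * c * P.L / ε)
          - P.L / ε * (7 * b * η / γ) * φ := by
      field_simp
      ring
    rw [h4]
    change _ ≤ (γ - γ ^ 2 / α) * P.maxVal 0 N e - (17 + 1 / 3) * (α * c * P.L / ε) - _ - _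
    change max (S.consistency / S.η - 1) 0 * P.L * _ ≤ _ at h3
    have hDε : 0 < α * c * P.L / ε := by positivity
    linarith
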